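/- Let $(\Omega,\mathcal B(\Omega),\mathbb P)$ be a metric space with its Borel $\sigma$-algebra and a probability measure, let $\vartheta:\Omega\to\Omega$ be measurable and preserve $\mathbb P$, let $X\subset\mathbb R^N$ be compact (with the Euclidean metric), and let $(T_\omega)_{\omega\in\Omega}$ be maps $T_\omega:X\to X$ such that $(\omega,x)\mapsto T_\omega(x)$ is measurable. Write $T^0_\omega=\mathrm{id}$, $T_\omega^n=T_{\vartheta^{n-1}\omega}\circ\dots\circ T_{\vartheta\omega}\circ T_\omega$ for $n\ge1$, and $S(\omega,x)=(\vartheta\omega,T_\omega x)$. Let $\mu$ be a probability measure on $\Omega\times X$ that is $S$-invariant and projects to $\mathbb P$ on $\Omega$, and let $\nu$ be its marginal on $X$. Let $B(x,r)$ denote the open ball in $X$, let $\tau_r^\omega(x,x_0)=\inf\{n\ge1: T^n_\omega x\in B(x_0,r)\}\in\{1,2,\dots\}\cup\{\infty\}$ be the quenched hitting time, let $\mu_{A}(E)=\mu(A\cap E)/\mu(A)$, and let $\underline d_\nu(x)=\liminf_{r\to0}\frac{\log\nu(B(x,r))}{\log r}\in[0,\infty]$ be the lower local dimension. Assume: (random-aperiodicity)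 $\mu\big(\{(\omega,x):\exists n\ge1,\ T^n_\omega x=x\}\big)=0$; (a) for $\nu$-almost every $x\in X$ there exist $a>0$ and $b\ge0$ such that $\nu\big(B(x,r)\setminus B(x,r-\rho)\big)\le r^{-b}\rho^a$ for all sufficiently small $r>0$ and all $0<\rho<r$; (b) there is a real sequence $(\theta_n)_{n\ge1}$ with $\lim_{n\to\infty}\theta_n n^p=0$ for every $p>0$ such that, for all $n\ge1$, all Lipschitz $\psi:X\to\mathbb R$ and all bounded measurable $\varphi:\Omega\times X\to\mathbb R$, $$\Big|\int_{\Omega\times X}\psi(x)\,\varphi(S^n(\omega,x))\,d\mu-\int_X\psi\,d\nu\int_{\Omega\times X}\varphi\,d\mu\Big|\le\|\psi\|_{\mathrm{Lip}}\,\|\varphi\|_\infty\,\theta_n,$$ where $\|\psi\|_{\mathrm{Lip}}$ is the sum of $\sup|\psi|$ and the least Lipschitz constant of $\psi$, and $\|\varphi\|_\infty=\sup|\varphi|$. Then for every $t\ge0$ and for $\nu$-almost every $x_0\in X$ such that $\underline d_\nu(x_0)>0$, $$\lim_{r\to0}\mu\Big(\Big\{(\omega,x)\in\Omega\times X:\ \tau_r^\omega(x,x_0)>\frac{t}{\nu(B(x_0,r))}\Big\}\Big)=e^{-t}$$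 and $$\lim_{r\to0}\mu_{\Omega\times B(x_0,r)}\Big(\Big\{(\omega,x)\in\Omega\times X:\ \tau_r^\omega(x,x_0)>\frac{t}{\nu(B(x_0,r))}\Big\}\Big)=e^{-t}.$$ -/

import Mathlib

open MeasureTheory ProbabilityTheory Filter Topology
open scoped ENNReal

/-- A random dynamical system on `X` over `(Ω, P, ϑ)`: a measurable `P`-preserving base
transformation `ϑ` of `Ω` and a (jointly measurable) family of maps `T ω : X → X`. -/
structure RandomDynSys (Ω X : Type*) [MeasurableSpace Ω] [MeasurableSpace X]
    (P : Measure Ω) where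
  /-- the base transformation `ϑ` -/
  base : Ω → Ω
  /-- the family of maps `T ω` -/
  T : Ω → X → X
  base_preserving : MeasurePreserving base P P
  measurable_T : Measurable (fun p : Ω × X => T p.1 p.2)

namespace RandomDynSys

variable {Ω X : Type*} [MeasurableSpace Ω] [MeasurableSpace X] {P : Measure Ω}

/-- `iter n ω = T (ϑ^(n-1) ω) ∘ ⋯ ∘ T (ϑ ω) ∘ T ω`, with `iter 0 ω = id`. -/
def iter (𝒯 : RandomDynSys Ω X P) : ℕ → Ω → X → X
  | 0, _, x => x
  | n + 1, ω, x => 𝒯.T (𝒯.base^[n] ω) (𝒯.iter n ω x)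

/-- The skew product `S (ω, x) = (ϑ ω, T ω x)`. -/
def skew (𝒯 : RandomDynSys Ω X P) (p : Ω × X) : Ω × X :=
  (𝒯.base p.1, 𝒯.T p.1 p.2)

/-- `μ` is an invariant measure of the system: it is a probability measure, invariant under
the skew product, whose projection to `Ω` is `P`. -/
structure IsInvariant (𝒯 : RandomDynSys Ω X P) (μ : Measure (Ω × X)) : Prop where
  isProbabilityMeasure : IsProbabilityMeasure μ
  skew_preserving : MeasurePreserving 𝒯.skew μ μ
  fst_eq : μ.fst = P

/-- The quenched hitting time `inf {n > 0 : T^n_ω x ∈ A}`, equal to `∞` if the random orbit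
never enters `A`. -/
noncomputable def hittingTime (𝒯 : RandomDynSys Ω X P) (A : Set X) (ω : Ω) (x : X) : ℕ∞ :=
  ⨅ (n : ℕ) (_ : 0 < n ∧ 𝒯.iter n ω x ∈ A), (n : ℕ∞)

/-- Random-aperiodicity: almost no point `(ω, x)` comes back exactly to `x` at a positive time. -/
def IsRandomAperiodic (𝒯 : RandomDynSys Ω X P) (μ : Measure (Ω × X)) : Prop :=
  μ {p : Ω × X | ∃ n : ℕ, 0 < n ∧ 𝒯.iter n p.1 p.2 = p.2} = 0

end RandomDynSys

/-- The sup norm of a (bounded) real function. -/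
noncomputable def supNorm {Y : Type*} (φ : Y → ℝ) : ℝ := ⨆ y, |φ y|

/-- The Lipschitz norm of a (bounded, Lipschitz) real function: its sup norm plus its least
Lipschitz constant. -/
noncomputable def lipNorm {X : Type*} [MetricSpace X] (ψ : X → ℝ) : ℝ :=
  supNorm ψ + sInf {K : ℝ | 0 ≤ K ∧ ∀ x y, |ψ x - ψ y| ≤ K * dist x y}

/-- Super-polynomial decay of correlations between Lipschitz observables on `X` and bounded
measurable observables on `Ω × X`. The sequence `θ` does not depend on the observables. -/
def RandomDynSys.HasSuperpolynomialMixedDecay {Ω X : Type*} [MeasurableSpace Ω] [MetricSpace X]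
    [MeasurableSpace X] {P : Measure Ω} (𝒯 : RandomDynSys Ω X P) (μ : Measure (Ω × X)) : Prop :=
  ∃ θ : ℕ → ℝ,
    (∀ p : ℝ, 0 < p → Tendsto (fun n : ℕ => θ n * (n : ℝ) ^ p) atTop (𝓝 0)) ∧
    ∀ n : ℕ, 1 ≤ n → ∀ (ψ : X → ℝ) (φ : Ω × X → ℝ),
      (∃ K, LipschitzWith K ψ) → Measurable φ → (∃ C : ℝ, ∀ q, |φ q| ≤ C) →
      |∫ q, ψ q.2 * φ (𝒯.skew^[n] q) ∂μ - (∫ x, ψ x ∂μ.snd) * ∫ q, φ q ∂μ|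
        ≤ lipNorm ψ * supNorm φ * θ n

/-- The annulus condition: for `ν`-almost every `x` there are `a > 0` and `b ≥ 0` with
`ν (B(x, r) \ B(x, r - ρ)) ≤ r ^ (-b) * ρ ^ a` for all small `r > 0` and all `0 < ρ < r`. -/
def AnnulusCondition {X : Type*} [MetricSpace X] [MeasurableSpace X] (ν : Measure X) : Prop :=
  ∀ᵐ x ∂ν, ∃ a b : ℝ, 0 < a ∧ 0 ≤ b ∧ ∃ r₀ : ℝ, 0 < r₀ ∧
    ∀ r : ℝ, 0 < r → r < r₀ → ∀ ρ : ℝ, 0 < ρ → ρ < r →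
      ν.real (Metric.ball x r \ Metric.ball x (r - ρ)) ≤ r ^ (-b) * ρ ^ a

/-- The lower local dimension `liminf_{r → 0+} log ν(B(x, r)) / log r`, an extended real
number (with `log 0 = -∞`). -/
noncomputable def lowerLocalDim {X : Type*} [MetricSpace X] [MeasurableSpace X] (ν : Measure X)
    (x : X) : EReal :=
  liminf (fun r : ℝ => ENNReal.log (ν (Metric.ball x r)) / ((Real.log r : ℝ) : EReal)) (𝓝[>] 0)

/-! Put U = Ω × B(x₀, r) and u = ν(B(x₀, r)), so that {τ > k} is `avoidSet 𝒯.skew U k`. Invariance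
gives μ(τ > k+1) = μ(τ > k) − μ(U ∩ {τ > k}). If conditioning on U changes every μ(τ > k) by at most
δ, the hitting law is within δ of the geometric law (1 − u)^k
(`abs_measureReal_avoidSet_sub_pow_le`); at k = ⌊t/u⌋ this tends to e^{-t} as u, δ → 0, and the
conditional law, being within δ, has the same limit.

To make δ small, ignore the times 1, …, n with n = ⌈r^{-e}⌉
(`abs_measureReal_inter_avoidSet_sub_le`). Relative to u the errors are the proportion of U
returning by time n, the product n·u, and the mixing error across the gap. At almost every x₀ of
positive lower dimension, r^m ≤ u ≤ r^{1/m} for some m and small r. Hence n·u → 0 for small e, and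
Lipschitz cutoffs, the annulus condition and superpolynomial decay handle the mixing error.

Early returns are the main difficulty. Mixing and Borel–Cantelli show that almost every point over a
regular set eventually returns no closer than 1/(4n^{2m}) at time n; aperiodicity covers the
remaining finitely many times (`MixedDecayBound.measure_iInter_fastReturnSet`). Besicovitch
differentiation turns this global statement into one about small balls around almost every x₀
(`ae_exists_eventually_measureReal_inter_ball_le`). -/

/-- The points whose orbit under `S` does not meet `U` at the times `1, …, k`. -/
def avoidSet {Y : Type*} (S : Y → Y) (U : Set Y) (k : ℕ) : Set Y :=
  {p | ∀ j, 0 < j → j ≤ k → S^[j] p ∉ U}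

/-! ### Hitting a single set under a measure-preserving map -/

section AvoidSet

variable {Y : Type*} {S : Y → Y} {U : Set Y}

theorem avoidSet_zero : avoidSet S U 0 = Set.univ := by
  ext p
  simp only [avoidSet, Set.mem_ofPred_eq, Set.mem_univ, iff_true]
  intro j hj hj'
  omega

theorem avoidSet_succ (k : ℕ) : avoidSet S U (k + 1) = S ⁻¹' (Uᶜ ∩ avoidSet S U k) := by
  ext p
  simp only [avoidSet, Set.mem_ofPred_eq, Set.mem_preimage, Set.mem_inter_iff, Set.mem_compl_iff]
  constructor
  · intro h
    refine ⟨h 1 one_pos (by omega), fun j hj hjk => ?_⟩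
    exact h (j + 1) (by omega) (by omega)
  · rintro ⟨h1, h2⟩ j hj hjk
    obtain ⟨i, rfl⟩ : ∃ i, j = i + 1 := ⟨j - 1, by omega⟩
    rcases Nat.eq_zero_or_pos i with rfl | hi
    · exact h1
    · exact h2 i hi (by omega)

theorem avoidSet_subset_preimage (k n : ℕ) :
    avoidSet S U k ⊆ S^[n] ⁻¹' avoidSet S U (k - n) := by
  intro p hp j hj hjk
  rw [← Function.iterate_add_apply]
  exact hp _ (by omega) (by omega)

theorem preimage_avoidSet_diff_subset (k n : ℕ) :
    (S^[n] ⁻¹' avoidSet S U (k - n)) \ avoidSet S U k ⊆ (avoidSet S U n)ᶜ := by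
  rintro p ⟨hp, hp'⟩ hn
  apply hp'
  intro j hj hjk
  by_cases h : j ≤ n
  · exact hn j hj h
  · have := hp (j - n) (by omega) (by omega)
    rwa [← Function.iterate_add_apply, Nat.sub_add_cancel (by omega)] at this

variable [MeasurableSpace Y] {μ : Measure Y}

theorem measurableSet_avoidSet (hS : Measurable S) (hU : MeasurableSet U) (k : ℕ) :
    MeasurableSet (avoidSet S U k) := by
  induction k with
  | zero => rw [avoidSet_zero]; exact MeasurableSet.univ
  | succ k ih => rw [avoidSet_succ]; exact hS (hU.compl.inter ih)

variable [IsProbabilityMeasure μ]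

/-- This recursion links hitting to returning: the mass lost at each step is the mass of the points
of U that have not yet returned. -/
theorem measureReal_avoidSet_succ (hS : MeasurePreserving S μ μ) (hU : MeasurableSet U) (k : ℕ) :
    μ.real (avoidSet S U (k + 1)) = μ.real (avoidSet S U k) - μ.real (U ∩ avoidSet S U k) := by
  have hm := measurableSet_avoidSet hS.measurable hU k
  rw [avoidSet_succ, measureReal_def,
    hS.measure_preimage (hU.compl.inter hm).nullMeasurableSet, ← measureReal_def]
  have := measureReal_inter_add_sdiff (μ := μ) (s := avoidSet S U k) hU
  rw [Set.inter_comm, Set.sdiff_eq, Set.inter_comm _ Uᶜ] at this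
  linarith

theorem measureReal_compl_avoidSet_le (hS : MeasurePreserving S μ μ) (hU : MeasurableSet U)
    (n : ℕ) : μ.real (avoidSet S U n)ᶜ ≤ n * μ.real U := by
  rw [probReal_compl_eq_one_sub (measurableSet_avoidSet hS.measurable hU n)]
  induction n with
  | zero => simp [avoidSet_zero]
  | succ k ih =>
    rw [measureReal_avoidSet_succ hS hU]
    have : μ.real (U ∩ avoidSet S U k) ≤ μ.real U := measureReal_mono Set.inter_subset_left
    push_cast
    linarith

/-- If conditioning on `U` changes the distribution of the hitting time of `U` by at most `δ`,
then this distribution is within `δ` of a geometric one. -/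
theorem abs_measureReal_avoidSet_sub_pow_le (hS : MeasurePreserving S μ μ) (hU : MeasurableSet U)
    {δ : ℝ} (hδ : 0 ≤ δ)
    (h : ∀ k, |μ.real (U ∩ avoidSet S U k) - μ.real U * μ.real (avoidSet S U k)|
      ≤ μ.real U * δ) (k : ℕ) :
    |μ.real (avoidSet S U k) - (1 - μ.real U) ^ k| ≤ δ := by
  induction k with
  | zero => simpa [avoidSet_zero] using hδ
  | succ k ih =>
    rw [measureReal_avoidSet_succ hS hU]
    have hu : μ.real U ≤ 1 := measureReal_le_one
    have h0 : 0 ≤ 1 - μ.real U := by linarith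
    -- The new error is (1 − u) times the old one minus the defect, which is at most u·δ; since (1 −
    -- u)δ + uδ = δ, errors do not accumulate.
    calc |μ.real (avoidSet S U k) - μ.real (U ∩ avoidSet S U k) - (1 - μ.real U) ^ (k + 1)|
        = |(1 - μ.real U) * (μ.real (avoidSet S U k) - (1 - μ.real U) ^ k)
          - (μ.real (U ∩ avoidSet S U k) - μ.real U * μ.real (avoidSet S U k))| := by
          congr 1; ring
      _ ≤ |(1 - μ.real U) * (μ.real (avoidSet S U k) - (1 - μ.real U) ^ k)|
          + |μ.real (U ∩ avoidSet S U k) - μ.real U * μ.real (avoidSet S U k)| := abs_sub _ _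
      _ ≤ (1 - μ.real U) * δ + μ.real U * δ := by
          gcongr
          · rw [abs_mul, abs_of_nonneg h0]
            gcongr
          · exact h k
      _ = δ := by ring

/-- Avoiding U up to k and avoiding it only at times n+1, …, k differ by a visit during 1, …, n.
Inside U this costs the early returns, on the whole space at most n·μ(U); mixing with error η
applies to the event with the gap. -/
theorem abs_measureReal_inter_avoidSet_sub_le (hS : MeasurePreserving S μ μ)
    (hU : MeasurableSet U) {n : ℕ} {η : ℝ}
    (hη : ∀ V, MeasurableSet V →
      |μ.real (U ∩ S^[n] ⁻¹' V) - μ.real U * μ.real V| ≤ η) (k : ℕ) :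
    |μ.real (U ∩ avoidSet S U k) - μ.real U * μ.real (avoidSet S U k)|
      ≤ μ.real (U \ avoidSet S U n) + μ.real U * (n * μ.real U) + η := by
  have hmeas := measurableSet_avoidSet hS.measurable hU
  -- Truncated subtraction: for k ≤ n this is the whole space, and the same argument applies.
  set V := avoidSet S U (k - n) with hV
  set W := avoidSet S U k with hW
  set Q := S^[n] ⁻¹' V with hQ
  have hQm : MeasurableSet Q := (hS.measurable.iterate n) (hmeas _)
  have hsub : W ⊆ Q := avoidSet_subset_preimage k n
  have hdiff : Q \ W ⊆ (avoidSet S U n)ᶜ := preimage_avoidSet_diff_subset k n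
  have hQV : μ.real Q = μ.real V := by
    rw [hQ, measureReal_def, (hS.iterate n).measure_preimage (hmeas _).nullMeasurableSet,
      ← measureReal_def]
  have h1 : μ.real (U ∩ W) ≤ μ.real (U ∩ Q) :=
    measureReal_mono (Set.inter_subset_inter_right _ hsub)
  have h2 : μ.real (U ∩ Q) ≤ μ.real (U ∩ W) + μ.real (U \ avoidSet S U n) := by
    refine (measureReal_mono ?_).trans (measureReal_union_le _ _)
    rintro p ⟨hpU, hpQ⟩
    by_cases hp : p ∈ W
    · exact Or.inl ⟨hpU, hp⟩
    · exact Or.inr ⟨hpU, hdiff ⟨hpQ, hp⟩⟩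
  have h3 : μ.real W ≤ μ.real V := hQV ▸ measureReal_mono hsub
  have h4 : μ.real V ≤ μ.real W + n * μ.real U := by
    rw [← hQV]
    calc μ.real Q ≤ μ.real (W ∪ (avoidSet S U n)ᶜ) := by
          refine measureReal_mono fun p hp => ?_
          by_cases hpW : p ∈ W
          · exact Or.inl hpW
          · exact Or.inr (hdiff ⟨hp, hpW⟩)
      _ ≤ μ.real W + μ.real (avoidSet S U n)ᶜ := measureReal_union_le _ _
      _ ≤ _ := by gcongr; exact measureReal_compl_avoidSet_le hS hU n
  have h5 := abs_le.1 (hη V (hmeas _))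
  have hu : 0 ≤ μ.real U := measureReal_nonneg
  have h6 : μ.real U * μ.real W ≤ μ.real U * μ.real V := by gcongr
  have h7 : μ.real U * μ.real V ≤ μ.real U * μ.real W + μ.real U * (n * μ.real U) := by
    rw [← mul_add]; gcongr
  have h8 : 0 ≤ μ.real (U \ avoidSet S U n) := measureReal_nonneg
  have h9 : 0 ≤ μ.real U * (n * μ.real U) := by positivity
  rw [abs_le]
  constructor <;> linarith [h5.1, h5.2]

end AvoidSet

/-! ### From the geometric to the exponential law -/

/-- The power is the exponential of (⌊t/u⌋·u)·(log(1 − u)/u), whose factors tend to t and −1. -/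
theorem tendsto_one_sub_pow_floor_div (t : ℝ) (ht : 0 ≤ t) :
    Tendsto (fun u : ℝ => (1 - u) ^ ⌊t / u⌋₊) (𝓝[>] 0) (𝓝 (Real.exp (-t))) := by
  have hfl : Tendsto (fun u : ℝ => (⌊t / u⌋₊ : ℝ) * u) (𝓝[>] 0) (𝓝 t) := by
    have hlow : Tendsto (fun u : ℝ => t - u) (𝓝[>] 0) (𝓝 t) := by
      have : Tendsto (fun u : ℝ => t - u) (𝓝 0) (𝓝 (t - 0)) :=
        (continuous_const.sub continuous_id).tendsto 0
      rw [sub_zero] at this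
      exact this.mono_left nhdsWithin_le_nhds
    refine tendsto_of_tendsto_of_tendsto_of_le_of_le' hlow tendsto_const_nhds ?_ ?_
    · filter_upwards [self_mem_nhdsWithin] with u (hu : 0 < u)
      have := Nat.lt_floor_add_one (t / u)
      rw [div_lt_iff₀ hu] at this
      linarith
    · filter_upwards [self_mem_nhdsWithin] with u (hu : 0 < u)
      have := Nat.floor_le (div_nonneg ht hu.le)
      rwa [le_div_iff₀ hu] at this
  have hlog : Tendsto (fun u : ℝ => Real.log (1 - u) / u) (𝓝[>] 0) (𝓝 (-1)) := by
    have h : HasDerivAt (fun u : ℝ => Real.log (1 - u)) (-1) 0 := by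
      have := ((hasDerivAt_id (0 : ℝ)).const_sub 1).log (by simp)
      simpa using this
    have := h.tendsto_slope_zero_right
    simpa [div_eq_inv_mul] using this
  have hexp := (Real.continuous_exp.tendsto _).comp (hfl.mul hlog)
  rw [mul_neg_one] at hexp
  refine hexp.congr' ?_
  have h1 : ∀ᶠ u : ℝ in 𝓝[>] 0, u < 1 := nhdsWithin_le_nhds (Iio_mem_nhds one_pos)
  filter_upwards [self_mem_nhdsWithin, h1] with u (hu : 0 < u) hu1
  have h2 : 0 < 1 - u := by linarith
  simp only [Function.comp_apply]
  rw [mul_assoc, mul_div_cancel₀ _ hu.ne', Real.exp_nat_mul, Real.exp_log h2]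

/-! ### Lipschitz cutoffs and mixing for balls -/

theorem lipNorm_le {X : Type*} [MetricSpace X] [Nonempty X] {ψ : X → ℝ} {K : NNReal}
    (hK : LipschitzWith K ψ) (h0 : ∀ x, 0 ≤ ψ x) (h1 : ∀ x, ψ x ≤ 1) :
    lipNorm ψ ≤ 1 + K := by
  unfold lipNorm supNorm
  gcongr
  · exact ciSup_le fun x => by rw [abs_of_nonneg (h0 x)]; exact h1 x
  · refine csInf_le ⟨0, fun y hy => hy.1⟩ ⟨K.2, fun x y => ?_⟩
    have := hK.dist_le_mul x y
    rwa [Real.dist_eq] at this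

theorem lipNorm_nonneg {X : Type*} [MetricSpace X] (ψ : X → ℝ) : 0 ≤ lipNorm ψ :=
  add_nonneg (Real.iSup_nonneg fun _ => abs_nonneg _) (Real.sInf_nonneg fun _ h => h.1)

/-- The Lipschitz function equal to `1` on `B(z, s - ρ)` and to `0` off `B(z, s)`. -/
noncomputable def ballCutoff {X : Type*} [MetricSpace X] (z : X) (s ρ : ℝ) (x : X) : ℝ :=
  max 0 (min 1 ((s - dist x z) / ρ))

section BallCutoff

variable {X : Type*} [MetricSpace X] {z x : X} {s ρ : ℝ}

theorem ballCutoff_nonneg : 0 ≤ ballCutoff z s ρ x := le_max_left _ _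

theorem ballCutoff_le_one : ballCutoff z s ρ x ≤ 1 := max_le zero_le_one (min_le_left _ _)

theorem ballCutoff_eq_one (hρ : 0 < ρ) (h : dist x z ≤ s - ρ) : ballCutoff z s ρ x = 1 := by
  have : 1 ≤ (s - dist x z) / ρ := by rw [le_div_iff₀ hρ]; linarith
  rw [ballCutoff, min_eq_left this, max_eq_right zero_le_one]

theorem ballCutoff_eq_zero (hρ : 0 < ρ) (h : s ≤ dist x z) : ballCutoff z s ρ x = 0 := by
  have : (s - dist x z) / ρ ≤ 0 := div_nonpos_of_nonpos_of_nonneg (by linarith) hρ.le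
  rw [ballCutoff, max_eq_left ((min_le_right _ _).trans this)]

theorem lipschitzWith_ballCutoff (hρ : 0 < ρ) :
    LipschitzWith (Real.toNNReal (1 / ρ)) (ballCutoff z s ρ) := by
  have h1 : LipschitzWith (Real.toNNReal (1 / ρ)) (fun x : X => (s - dist x z) / ρ) := by
    refine LipschitzWith.of_dist_le_mul fun x y => ?_
    rw [Real.coe_toNNReal _ (by positivity), Real.dist_eq, ← sub_div, abs_div, abs_of_pos hρ,
      div_eq_inv_mul, one_div]
    gcongr
    rw [sub_sub_sub_cancel_left, abs_sub_comm]
    exact abs_dist_sub_le x y z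
  exact (h1.const_min 1).const_max 0

end BallCutoff

namespace RandomDynSys

variable {Ω X : Type*} [MeasurableSpace Ω] [MeasurableSpace X] {P : Measure Ω}

theorem skew_iterate (𝒯 : RandomDynSys Ω X P) (n : ℕ) (p : Ω × X) :
    𝒯.skew^[n] p = (𝒯.base^[n] p.1, 𝒯.iter n p.1 p.2) := by
  induction n with
  | zero => rfl
  | succ n ih =>
    rw [Function.iterate_succ_apply', ih, Function.iterate_succ_apply']
    rfl

theorem measurable_skew (𝒯 : RandomDynSys Ω X P) : Measurable 𝒯.skew :=
  (𝒯.base_preserving.measurable.comp measurable_fst).prodMk 𝒯.measurable_T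

theorem measurable_iter (𝒯 : RandomDynSys Ω X P) (n : ℕ) :
    Measurable fun p : Ω × X => 𝒯.iter n p.1 p.2 := by
  have : (fun p : Ω × X => 𝒯.iter n p.1 p.2) = fun p => (𝒯.skew^[n] p).2 := by
    ext p; rw [skew_iterate]
  rw [this]
  exact measurable_snd.comp (𝒯.measurable_skew.iterate n)

/-- The sequence `θ` bounds the correlations between Lipschitz observables on `X` and bounded
measurable observables on `Ω × X`. -/
def MixedDecayBound [MetricSpace X] (𝒯 : RandomDynSys Ω X P) (μ : Measure (Ω × X))
    (θ : ℕ → ℝ) : Prop :=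
  ∀ n : ℕ, 1 ≤ n → ∀ (ψ : X → ℝ) (φ : Ω × X → ℝ),
    (∃ K, LipschitzWith K ψ) → Measurable φ → (∃ C : ℝ, ∀ q, |φ q| ≤ C) →
    |∫ q, ψ q.2 * φ (𝒯.skew^[n] q) ∂μ - (∫ x, ψ x ∂μ.snd) * ∫ q, φ q ∂μ|
      ≤ lipNorm ψ * supNorm φ * θ n

end RandomDynSys

namespace RandomDynSys.MixedDecayBound

variable {Ω X : Type*} [MeasurableSpace Ω] [MetricSpace X] [MeasurableSpace X]
  {P : Measure Ω} {𝒯 : RandomDynSys Ω X P} {μ : Measure (Ω × X)} {θ : ℕ → ℝ}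

/-- Decay is applied to the indicator of V, so V needs only measurability. The absolute value on θ
allows negative terms. -/
theorem abs_setIntegral_sub_le [Nonempty X]
    (hS : Measurable 𝒯.skew) (hθ : 𝒯.MixedDecayBound μ θ) {n : ℕ} (hn : 1 ≤ n) {ψ : X → ℝ}
    {K : NNReal} (hK : LipschitzWith K ψ) (h0 : ∀ x, 0 ≤ ψ x) (h1 : ∀ x, ψ x ≤ 1)
    {V : Set (Ω × X)} (hV : MeasurableSet V) :
    |∫ q in 𝒯.skew^[n] ⁻¹' V, ψ q.2 ∂μ - (∫ x, ψ x ∂μ.snd) * μ.real V| ≤ (1 + K) * |θ n| := by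
  have hb : ∀ q, |V.indicator (fun _ => (1 : ℝ)) q| ≤ 1 := fun q => by
    by_cases h : q ∈ V <;> simp [h]
  have key := hθ n hn ψ (V.indicator fun _ => 1) ⟨K, hK⟩ (measurable_const.indicator hV) ⟨1, hb⟩
  have e1 : ∫ q, V.indicator (fun _ => (1 : ℝ)) q ∂μ = μ.real V := by
    rw [integral_indicator hV]; simp
  have e2 : ∫ q, ψ q.2 * V.indicator (fun _ => (1 : ℝ)) (𝒯.skew^[n] q) ∂μ
      = ∫ q in 𝒯.skew^[n] ⁻¹' V, ψ q.2 ∂μ := by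
    rw [← integral_indicator ((hS.iterate n) hV)]
    congr 1
    ext q
    by_cases h : 𝒯.skew^[n] q ∈ V <;> simp [Set.indicator, h]
  rw [e1, e2] at key
  refine key.trans ?_
  have hs1 : supNorm (V.indicator fun _ => (1 : ℝ)) ≤ 1 := Real.iSup_le hb zero_le_one
  have hs0 : 0 ≤ supNorm (V.indicator fun _ => (1 : ℝ)) := Real.iSup_nonneg fun _ => abs_nonneg _
  calc lipNorm ψ * supNorm (V.indicator fun _ => (1 : ℝ)) * θ n
      ≤ lipNorm ψ * supNorm (V.indicator fun _ => (1 : ℝ)) * |θ n| :=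
        mul_le_mul_of_nonneg_left (le_abs_self _) (mul_nonneg (lipNorm_nonneg ψ) hs0)
    _ ≤ (1 + K) * 1 * |θ n| := by
        gcongr
        exact lipNorm_le hK h0 h1
    _ = _ := by ring

variable [BorelSpace X] [IsProbabilityMeasure μ]

/-- Mixing between a ball and the far future, up to the measure of a thin annulus. -/
theorem abs_measureReal_ball_inter_sub_le [Nonempty X]
    (hS : Measurable 𝒯.skew) (hθ : 𝒯.MixedDecayBound μ θ) {n : ℕ} (hn : 1 ≤ n) (x₀ : X)
    {r ρ : ℝ} (hρ : 0 < ρ) {V : Set (Ω × X)} (hV : MeasurableSet V) :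
    |μ.real ((Set.univ ×ˢ Metric.ball x₀ r) ∩ 𝒯.skew^[n] ⁻¹' V)
        - μ.snd.real (Metric.ball x₀ r) * μ.real V|
      ≤ μ.snd.real (Metric.ball x₀ r \ Metric.ball x₀ (r - ρ)) + (1 + 1 / ρ) * |θ n| := by
  set A := Metric.ball x₀ r with hA
  set A' := Metric.ball x₀ (r - ρ) with hA'
  set ψ := ballCutoff x₀ r ρ with hψ
  set W := 𝒯.skew^[n] ⁻¹' V with hW
  have hWm : MeasurableSet W := (hS.iterate n) hV
  have hAm : MeasurableSet A := Metric.isOpen_ball.measurableSet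
  have hA'm : MeasurableSet A' := Metric.isOpen_ball.measurableSet
  have key := hθ.abs_setIntegral_sub_le hS hn (lipschitzWith_ballCutoff (z := x₀) (s := r) hρ)
    (fun _ => ballCutoff_nonneg) (fun _ => ballCutoff_le_one) hV
  rw [Real.coe_toNNReal _ (by positivity)] at key
  have hψm : Measurable ψ := (lipschitzWith_ballCutoff hρ).continuous.measurable
  have hle1 : ∀ x, ψ x ≤ A.indicator (fun _ => (1 : ℝ)) x := fun x => by
    by_cases h : x ∈ A
    · simpa [h] using ballCutoff_le_one
    · rw [hA, Metric.mem_ball, not_lt] at h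
      rw [hψ, ballCutoff_eq_zero hρ h]
      exact Set.indicator_nonneg (fun _ _ => zero_le_one) _
  have hle2 : ∀ x, A.indicator (fun _ => (1 : ℝ)) x
      ≤ ψ x + (A \ A').indicator (fun _ => (1 : ℝ)) x := fun x => by
    have hψ0 : 0 ≤ ψ x := ballCutoff_nonneg
    by_cases h : x ∈ A
    · by_cases h' : x ∈ A'
      · have : ψ x = 1 := ballCutoff_eq_one hρ (Metric.mem_ball.1 h').le
        simp [h, h', this]
      · simpa [h, h'] using hψ0
    · simpa [h] using hψ0
  have hψint : ∀ ν : Measure X, IsFiniteMeasure ν → Integrable ψ ν := fun ν _ =>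
    Integrable.of_bound hψm.aestronglyMeasurable 1 (Eventually.of_forall fun x => by
      rw [Real.norm_of_nonneg ballCutoff_nonneg]; exact ballCutoff_le_one)
  have hind : ∀ (ν : Measure X) (B : Set X), IsFiniteMeasure ν → MeasurableSet B →
      Integrable (B.indicator fun _ => (1 : ℝ)) ν := fun ν B _ hB =>
    (integrable_const 1).indicator hB
  have hintr : ∀ (ν : Measure X) (B : Set X), MeasurableSet B →
      ∫ x, B.indicator (fun _ => (1 : ℝ)) x ∂ν = ν.real B := fun ν B hB => by
    rw [integral_indicator hB]; simp
  -- The sandwich ψ ≤ 1_A ≤ ψ + 1_{A∖A'} is used for two measures: the marginal of μ and that of μ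
  -- restricted to W.
  have comp : ∀ (ν : Measure X) [IsFiniteMeasure ν], ∫ x, ψ x ∂ν ≤ ν.real A ∧
      ν.real A ≤ ∫ x, ψ x ∂ν + ν.real (A \ A') := fun ν _ => by
    constructor
    · rw [← hintr ν A hAm]
      exact integral_mono (hψint ν inferInstance) (hind ν A inferInstance hAm) hle1
    · rw [← hintr ν A hAm, ← hintr ν _ (hAm.diff hA'm),
        ← integral_add (hψint ν inferInstance) (hind ν _ inferInstance (hAm.diff hA'm))]
      exact integral_mono (hind ν A inferInstance hAm)
        ((hψint ν inferInstance).add (hind ν _ inferInstance (hAm.diff hA'm))) hle2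
  have sndW : ∀ B, MeasurableSet B → (μ.restrict W).snd.real B
      = μ.real ((Set.univ ×ˢ B) ∩ W) := fun B hB => by
    rw [measureReal_def, Measure.snd_apply hB, Measure.restrict_apply (measurable_snd hB),
      Set.univ_prod, ← measureReal_def]
  have intW : ∫ x, ψ x ∂(μ.restrict W).snd = ∫ q in W, ψ q.2 ∂μ :=
    integral_map measurable_snd.aemeasurable hψm.aestronglyMeasurable
  obtain ⟨a1, a2⟩ := comp (μ.restrict W).snd
  obtain ⟨b1, b2⟩ := comp μ.snd
  rw [intW, sndW _ hAm] at a1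
  rw [intW, sndW _ hAm, sndW _ (hAm.diff hA'm)] at a2
  have hann : μ.real ((Set.univ ×ˢ (A \ A')) ∩ W) ≤ μ.snd.real (A \ A') := by
    rw [measureReal_def, measureReal_def, Measure.snd_apply (hAm.diff hA'm), ← Set.univ_prod]
    exact measureReal_mono Set.inter_subset_left
  have hV1 : μ.real V ≤ 1 := measureReal_le_one
  have hV0 : 0 ≤ μ.real V := measureReal_nonneg
  have hann0 : 0 ≤ μ.snd.real (A \ A') := measureReal_nonneg
  obtain ⟨k1, k2⟩ := abs_le.1 key
  have c1 : (∫ x, ψ x ∂μ.snd) * μ.real V ≤ μ.snd.real A * μ.real V := by gcongr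
  have c2 : μ.snd.real A * μ.real V
      ≤ (∫ x, ψ x ∂μ.snd) * μ.real V + μ.snd.real (A \ A') := by
    calc μ.snd.real A * μ.real V ≤ (∫ x, ψ x ∂μ.snd + μ.snd.real (A \ A')) * μ.real V := by
          gcongr
      _ ≤ _ := by
          rw [add_mul]
          gcongr
          exact mul_le_of_le_one_right hann0 hV1
  rw [abs_le]
  constructor <;> linarith

end RandomDynSys.MixedDecayBound

/-! ### Nets, regular points and the rarity of close returns -/

/-- Half-radius balls around s-separated points are disjoint and of mass at least c, so there are at
most 1/c of them; a separated set of maximal cardinality is an s-net. -/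
theorem exists_maximal_separated_finset {X : Type*} [MetricSpace X] [MeasurableSpace X]
    [BorelSpace X] (ν : Measure X) [IsProbabilityMeasure ν] (G : Set X) {s c : ℝ} (hs : 0 < s)
    (hc : 0 < c) (hG : ∀ x ∈ G, c ≤ ν.real (Metric.ball x (s / 2))) :
    ∃ F : Finset X, ↑F ⊆ G ∧ (F.card : ℝ) ≤ 1 / c ∧ ∀ x ∈ G, ∃ z ∈ F, dist x z ≤ s := by
  classical
  set A : Set ℕ := {k | ∃ F : Finset X, ↑F ⊆ G ∧
    (F : Set X).Pairwise (fun x y => s < dist x y) ∧ F.card = k} with hA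
  have hcard : ∀ F : Finset X, ↑F ⊆ G → (F : Set X).Pairwise (fun x y => s < dist x y) →
      (F.card : ℝ) ≤ 1 / c := by
    intro F hFG hF
    rw [le_div_iff₀ hc]
    have hdisj : (F : Set X).PairwiseDisjoint fun z => Metric.ball z (s / 2) := by
      intro x hx y hy hxy
      exact Metric.ball_disjoint_ball (by linarith [hF hx hy hxy])
    calc (F.card : ℝ) * c = ∑ z ∈ F, c := by simp
      _ ≤ ∑ z ∈ F, ν.real (Metric.ball z (s / 2)) :=
          Finset.sum_le_sum fun z hz => hG z (hFG hz)
      _ = ν.real (⋃ z ∈ F, Metric.ball z (s / 2)) :=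
          (measureReal_biUnion_finset hdisj fun z _ => Metric.isOpen_ball.measurableSet).symm
      _ ≤ 1 := measureReal_le_one
  have hbdd : BddAbove A := by
    refine ⟨⌊1 / c⌋₊, ?_⟩
    rintro k ⟨F, h1, h2, rfl⟩
    exact Nat.le_floor (hcard F h1 h2)
  have hne : A.Nonempty := ⟨0, ∅, by simp, by simp, rfl⟩
  obtain ⟨F, hFG, hF, hFc⟩ := Nat.sSup_mem hne hbdd
  refine ⟨F, hFG, hcard F hFG hF, fun x hx => ?_⟩
  by_contra! hcon
  have hxF : x ∉ F := fun h => by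
    have := hcon x h
    rw [dist_self] at this
    linarith
  have hmem : F.card + 1 ∈ A := by
    refine ⟨insert x F, ?_, ?_, Finset.card_insert_of_notMem hxF⟩
    · rw [Finset.coe_insert]
      exact Set.insert_subset hx hFG
    · rw [Finset.coe_insert]
      rintro a (rfl | ha) b (rfl | hb) hab
      · exact absurd rfl hab
      · exact hcon b hb
      · rw [dist_comm]; exact hcon a ha
      · exact hF ha hb hab
  have := le_csSup hbdd hmem
  omega

/-- The points at which `ν` has, at the scales `1 / n` with `n ≥ l`, local dimension between
`1 / m` and `m`. -/
def regularPoints {X : Type*} [MetricSpace X] [MeasurableSpace X] (ν : Measure X) (m l : ℕ) :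
    Set X :=
  {x | ∀ n : ℕ, l ≤ n → ((n : ℝ)⁻¹) ^ m ≤ ν.real (Metric.ball x (n : ℝ)⁻¹) ∧
    ν.real (Metric.ball x (n : ℝ)⁻¹) ^ m ≤ (n : ℝ)⁻¹}

theorem measurable_measureReal_ball {X : Type*} [MetricSpace X] [MeasurableSpace X]
    [BorelSpace X] [SecondCountableTopology X] (ν : Measure X) [IsFiniteMeasure ν] (s : ℝ) :
    Measurable fun x => ν.real (Metric.ball x s) := by
  have : MeasurableSet {p : X × X | dist p.2 p.1 < s} :=
    measurableSet_lt (measurable_snd.dist measurable_fst) measurable_const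
  exact (measurable_measure_prodMk_left this).ennreal_toReal

theorem measurableSet_regularPoints {X : Type*} [MetricSpace X] [MeasurableSpace X]
    [BorelSpace X] [SecondCountableTopology X] (ν : Measure X) [IsFiniteMeasure ν] (m l : ℕ) :
    MeasurableSet (regularPoints ν m l) := by
  have : regularPoints ν m l = ⋂ n : ℕ, ⋂ _ : l ≤ n,
      {x | ((n : ℝ)⁻¹) ^ m ≤ ν.real (Metric.ball x (n : ℝ)⁻¹)} ∩
      {x | ν.real (Metric.ball x (n : ℝ)⁻¹) ^ m ≤ (n : ℝ)⁻¹} := by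
    ext x
    simp [regularPoints]
  rw [this]
  refine MeasurableSet.iInter fun n => MeasurableSet.iInter fun _ => ?_
  have h := measurable_measureReal_ball ν (n : ℝ)⁻¹
  exact (measurableSet_le measurable_const h).inter
    (measurableSet_le (h.pow_const m) measurable_const)

namespace RandomDynSys

variable {Ω X : Type*} [MeasurableSpace Ω] [MetricSpace X] [MeasurableSpace X]
  {P : Measure Ω}

/-- The points which come back at time `n` within distance `s` of themselves. -/
def closeReturnSet (𝒯 : RandomDynSys Ω X P) (n : ℕ) (s : ℝ) : Set (Ω × X) :=
  {p | dist (𝒯.iter n p.1 p.2) p.2 < s}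

variable [BorelSpace X] [SecondCountableTopology X]

theorem measurableSet_closeReturnSet (𝒯 : RandomDynSys Ω X P) (n : ℕ) (s : ℝ) :
    MeasurableSet (𝒯.closeReturnSet n s) :=
  measurableSet_lt ((𝒯.measurable_iter n).dist measurable_snd) measurable_const

end RandomDynSys

namespace RandomDynSys.MixedDecayBound

variable {Ω X : Type*} [MeasurableSpace Ω] [MetricSpace X] [MeasurableSpace X]
  {P : Measure Ω} {𝒯 : RandomDynSys Ω X P} {μ : Measure (Ω × X)} {θ : ℕ → ℝ}
  [BorelSpace X] [SecondCountableTopology X] [IsProbabilityMeasure μ]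

/-- The cutoff is a maximum of bumps on the balls B(z, 2s). Adding one centre adds an increment
supported near z, where a close return lands in B(z, 3s); decay bounds its contribution. The
increments telescope, so the main term is M∫h, with no overlap multiplicity. -/
theorem exists_cutoff_of_finset [Nonempty X] (hθ : 𝒯.MixedDecayBound μ θ) {n : ℕ} (hn : 1 ≤ n)
    {s M : ℝ} (hs : 0 < s) (F : Finset X)
    (hF : ∀ z ∈ F, μ.snd.real (Metric.ball z (3 * s)) ≤ M) :
    ∃ h : X → ℝ, LipschitzWith (Real.toNNReal (1 / s)) h ∧ (∀ x, 0 ≤ h x) ∧ (∀ x, h x ≤ 1) ∧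
      (∀ x, ∀ z ∈ F, dist x z ≤ s → h x = 1) ∧
      ∫ q in 𝒯.closeReturnSet n s, h q.2 ∂μ
        ≤ M * ∫ x, h x ∂μ.snd + F.card * ((1 + 2 / s) * |θ n|) := by
  classical
  induction F using Finset.induction_on with
  | empty =>
    refine ⟨fun _ => 0, LipschitzWith.const' 0, fun _ => le_rfl, fun _ => zero_le_one, ?_, ?_⟩
    · simp
    · simp
  | insert z F hz ih =>
    obtain ⟨h, hL, h0, h1, hone, hint⟩ := ih fun w hw => hF w (Finset.mem_insert_of_mem hw)
    set g := ballCutoff z (2 * s) s with hg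
    have hgL : LipschitzWith (Real.toNNReal (1 / s)) g := lipschitzWith_ballCutoff hs
    -- A maximum keeps the constant 1/s, so the Lipschitz norm does not grow with F.
    have hmaxL : LipschitzWith (Real.toNNReal (1 / s)) fun x => max (h x) (g x) := by
      simpa using hL.max hgL
    set ψ : X → ℝ := fun x => max (h x) (g x) - h x with hψ
    have hψL : LipschitzWith (Real.toNNReal (1 / s) + Real.toNNReal (1 / s)) ψ := hmaxL.sub hL
    have hg1 : ∀ x, g x ≤ 1 := fun _ => ballCutoff_le_one
    have hψ0 : ∀ x, 0 ≤ ψ x := fun x => sub_nonneg.2 (le_max_left _ _)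
    have hψ1 : ∀ x, ψ x ≤ 1 := fun x => by
      have : max (h x) (g x) ≤ 1 := max_le (h1 x) (hg1 x)
      have := h0 x
      simp only [hψ]
      linarith
    have hψz : ∀ x, 2 * s ≤ dist x z → ψ x = 0 := fun x hx => by
      have : g x = 0 := ballCutoff_eq_zero hs hx
      simp only [hψ, this, max_eq_left (h0 x), sub_self]
    have hint' : ∀ (f : X → ℝ), Continuous f → (∀ x, 0 ≤ f x) → (∀ x, f x ≤ 1) →
        Integrable f μ.snd := fun f hf hf0 hf1 =>
      Integrable.of_bound hf.measurable.aestronglyMeasurable 1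
        (Eventually.of_forall fun x => by rw [Real.norm_of_nonneg (hf0 x)]; exact hf1 x)
    have hint2 : ∀ (f : X → ℝ), Continuous f → (∀ x, 0 ≤ f x) → (∀ x, f x ≤ 1) →
        Integrable (fun q : Ω × X => f q.2) μ := fun f hf hf0 hf1 =>
      (hint' f hf hf0 hf1).comp_measurable measurable_snd
    have hV : MeasurableSet (Set.univ ×ˢ Metric.ball z (3 * s) : Set (Ω × X)) :=
      MeasurableSet.univ.prod Metric.isOpen_ball.measurableSet
    have key := hθ.abs_setIntegral_sub_le 𝒯.measurable_skew hn hψL hψ0 hψ1 hV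
    have hVr : μ.real (Set.univ ×ˢ Metric.ball z (3 * s) : Set (Ω × X))
        = μ.snd.real (Metric.ball z (3 * s)) := by
      rw [measureReal_def, measureReal_def, Measure.snd_apply Metric.isOpen_ball.measurableSet,
        Set.univ_prod]
    rw [hVr] at key
    have hKK : ((Real.toNNReal (1 / s) + Real.toNNReal (1 / s) : NNReal) : ℝ) = 2 / s := by
      rw [NNReal.coe_add, Real.coe_toNNReal _ (by positivity)]
      ring
    rw [hKK] at key
    have hEm := 𝒯.measurableSet_closeReturnSet n s
    have hVm := (𝒯.measurable_skew.iterate n) hV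
    have hE : ∫ q in 𝒯.closeReturnSet n s, ψ q.2 ∂μ
        ≤ ∫ q in 𝒯.skew^[n] ⁻¹' (Set.univ ×ˢ Metric.ball z (3 * s)), ψ q.2 ∂μ := by
      rw [← integral_indicator hEm, ← integral_indicator hVm]
      have hi := hint2 ψ hψL.continuous hψ0 hψ1
      refine integral_mono (hi.indicator hEm) (hi.indicator hVm) fun q => ?_
      by_cases hq : q ∈ 𝒯.closeReturnSet n s
      · rw [Set.indicator_of_mem hq]
        by_cases hd : 2 * s ≤ dist q.2 z
        · rw [hψz _ hd]
          exact Set.indicator_nonneg (fun q _ => hψ0 q.2) _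
        · have hmem : q ∈ 𝒯.skew^[n] ⁻¹' (Set.univ ×ˢ Metric.ball z (3 * s)) := by
            rw [Set.mem_preimage, skew_iterate]
            refine ⟨trivial, ?_⟩
            have h1 : dist (𝒯.iter n q.1 q.2) q.2 < s := hq
            have h2 := dist_triangle (𝒯.iter n q.1 q.2) q.2 z
            rw [Metric.mem_ball]
            linarith
          rw [Set.indicator_of_mem hmem]
      · rw [Set.indicator_of_notMem hq]
        exact Set.indicator_nonneg (fun q _ => hψ0 q.2) _
    have hψi0 : 0 ≤ ∫ x, ψ x ∂μ.snd := integral_nonneg hψ0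
    have hM : (∫ x, ψ x ∂μ.snd) * μ.snd.real (Metric.ball z (3 * s))
        ≤ M * ∫ x, ψ x ∂μ.snd := by
      rw [mul_comm]
      exact mul_le_mul_of_nonneg_right (hF z (Finset.mem_insert_self z F)) hψi0
    have hsplit : ∀ x, max (h x) (g x) = h x + ψ x := fun x => by simp only [hψ]; ring
    refine ⟨fun x => max (h x) (g x), hmaxL, fun x => (h0 x).trans (le_max_left _ _),
      fun x => max_le (h1 x) (hg1 x), ?_, ?_⟩
    · intro x w hw hxw
      rcases Finset.mem_insert.1 hw with rfl | hw
      · have : g x = 1 := ballCutoff_eq_one hs (by linarith)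
        change max (h x) (g x) = 1
        rw [this]
        exact max_eq_right (h1 x)
      · change max (h x) (g x) = 1
        rw [hone x w hw hxw]
        exact max_eq_left (hg1 x)
    · simp only [hsplit]
      rw [integral_add (hint2 h hL.continuous h0 h1).integrableOn
        (hint2 ψ hψL.continuous hψ0 hψ1).integrableOn,
        integral_add (hint' h hL.continuous h0 h1) (hint' ψ hψL.continuous hψ0 hψ1),
        Finset.card_insert_of_notMem hz]
      push_cast
      have := (abs_le.1 key).2
      linarith

theorem measureReal_closeReturnSet_inter_le [Nonempty X] (hθ : 𝒯.MixedDecayBound μ θ) {n : ℕ}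
    (hn : 1 ≤ n) {s M c : ℝ} (hs : 0 < s) (hM : 0 ≤ M) (hc : 0 < c) {G : Set X}
    (hG1 : ∀ x ∈ G, μ.snd.real (Metric.ball x (3 * s)) ≤ M)
    (hG2 : ∀ x ∈ G, c ≤ μ.snd.real (Metric.ball x (s / 2))) :
    μ.real (𝒯.closeReturnSet n s ∩ Prod.snd ⁻¹' G)
      ≤ M + 1 / c * ((1 + 2 / s) * |θ n|) := by
  obtain ⟨F, hFG, hFc, hcov⟩ := exists_maximal_separated_finset μ.snd G hs hc hG2
  obtain ⟨h, hL, h0, h1, hone, hint⟩ := hθ.exists_cutoff_of_finset hn hs F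
    fun z hz => hG1 z (hFG hz)
  set E := 𝒯.closeReturnSet n s with hE
  have hEm : MeasurableSet E := 𝒯.measurableSet_closeReturnSet n s
  set H : Set (Ω × X) := Prod.snd ⁻¹' {x | 1 ≤ h x} with hH
  have hHm : MeasurableSet H :=
    measurable_snd (measurableSet_le measurable_const hL.continuous.measurable)
  have hsub : E ∩ Prod.snd ⁻¹' G ⊆ H ∩ E := by
    rintro q ⟨hqE, hqG⟩
    obtain ⟨z, hz, hd⟩ := hcov q.2 hqG
    exact ⟨(hone q.2 z hz hd).ge, hqE⟩
  have hhi : Integrable h μ.snd :=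
    Integrable.of_bound hL.continuous.measurable.aestronglyMeasurable 1
      (Eventually.of_forall fun x => by rw [Real.norm_of_nonneg (h0 x)]; exact h1 x)
  have hi : Integrable (fun q : Ω × X => h q.2) μ := hhi.comp_measurable measurable_snd
  have h2 : μ.real (H ∩ E) ≤ ∫ q in E, h q.2 ∂μ := by
    have : ∫ q in E, H.indicator (fun _ => (1 : ℝ)) q ∂μ = μ.real (H ∩ E) := by
      rw [integral_indicator hHm]
      simp [Measure.real, Measure.restrict_apply, hHm]
    rw [← this]
    refine integral_mono ((integrable_const 1).indicator hHm) hi.integrableOn fun q => ?_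
    by_cases hq : q ∈ H
    · rw [Set.indicator_of_mem hq]; exact hq
    · rw [Set.indicator_of_notMem hq]; exact h0 q.2
  have h3 : ∫ x, h x ∂μ.snd ≤ 1 := by
    calc ∫ x, h x ∂μ.snd ≤ ∫ _, (1 : ℝ) ∂μ.snd := integral_mono hhi (integrable_const 1) h1
      _ = 1 := by simp
  calc μ.real (E ∩ Prod.snd ⁻¹' G) ≤ μ.real (H ∩ E) := measureReal_mono hsub
    _ ≤ _ := h2
    _ ≤ _ := hint
    _ ≤ M * 1 + 1 / c * ((1 + 2 / s) * |θ n|) := by gcongr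
    _ = _ := by ring

/-- Borel–Cantelli at distance s = 1/(4n^{2m}): on regular points balls of radius 3s have mass at
most n^{-2}, while the net size and Lipschitz norms are polynomial in n and are absorbed by θ. -/
theorem ae_eventually_le_dist_iter (hθ : 𝒯.MixedDecayBound μ θ)
    (hθ' : ∀ p : ℕ, Tendsto (fun n : ℕ => θ n * (n : ℝ) ^ p) atTop (𝓝 0)) {m : ℕ} (hm : 1 ≤ m)
    (l : ℕ) :
    ∀ᵐ q ∂μ, q.2 ∈ regularPoints μ.snd m l →
      ∀ᶠ n : ℕ in atTop, 1 / (4 * (n : ℝ) ^ (2 * m)) ≤ dist (𝒯.iter n q.1 q.2) q.2 := by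
  have : Nonempty X := by
    obtain ⟨q⟩ : Nonempty (Ω × X) := nonempty_of_isProbabilityMeasure μ
    exact ⟨q.2⟩
  set G := regularPoints μ.snd m l with hG
  set E : ℕ → Set (Ω × X) := fun n =>
    𝒯.closeReturnSet n (1 / (4 * (n : ℝ) ^ (2 * m))) ∩ Prod.snd ⁻¹' G with hE
  have hbound : ∀ n, max l 1 ≤ n → μ.real (E n) ≤ 1 / (n : ℝ) ^ 2
      + 8 ^ m * (9 * (|θ n| * (n : ℝ) ^ (2 * m * m + 2 * m))) := by
    intro n hn
    have hn1 : 1 ≤ n := (le_max_right _ _).trans hn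
    have hnl : l ≤ n := (le_max_left _ _).trans hn
    have hn1' : (1 : ℝ) ≤ n := by exact_mod_cast hn1
    have hN : 1 ≤ (n : ℝ) ^ (2 * m) := one_le_pow₀ hn1'
    have hNl : l ≤ n ^ (2 * m) := hnl.trans (Nat.le_self_pow (by omega) n)
    have hup : ∀ x ∈ G, μ.snd.real (Metric.ball x (3 * (1 / (4 * (n : ℝ) ^ (2 * m)))))
        ≤ 1 / (n : ℝ) ^ 2 := by
      intro x hx
      have h := (hx (n ^ (2 * m)) hNl).2
      push_cast at h
      have hsub : Metric.ball x (3 * (1 / (4 * (n : ℝ) ^ (2 * m))))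
          ⊆ Metric.ball x ((n : ℝ) ^ (2 * m))⁻¹ := by
        apply Metric.ball_subset_ball
        rw [inv_eq_one_div, ← mul_div_assoc, div_le_div_iff₀ (by positivity) (by positivity)]
        nlinarith
      refine (measureReal_mono hsub).trans ?_
      refine le_of_pow_le_pow_left₀ (n := m) (by omega) (by positivity) (h.trans_eq ?_)
      rw [div_pow, one_pow, ← pow_mul, one_div]
    have hlow : ∀ x ∈ G, ((8 * (n : ℝ) ^ (2 * m))⁻¹) ^ m
        ≤ μ.snd.real (Metric.ball x (1 / (4 * (n : ℝ) ^ (2 * m)) / 2)) := by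
      intro x hx
      have h := (hx (8 * n ^ (2 * m)) (by omega)).1
      push_cast at h
      -- The radius s/2 is the inverse of the integer 8n^{2m}, a scale at which regularity applies.
      convert h using 3
      field_simp
      norm_num
    have key := hθ.measureReal_closeReturnSet_inter_le hn1
      (s := 1 / (4 * (n : ℝ) ^ (2 * m))) (by positivity)
      (M := 1 / (n : ℝ) ^ 2) (by positivity) (c := ((8 * (n : ℝ) ^ (2 * m))⁻¹) ^ m)
      (by positivity) hup hlow
    refine key.trans ?_
    gcongr ?_ + ?_
    · exact le_rfl
    calc 1 / ((8 * (n : ℝ) ^ (2 * m))⁻¹) ^ m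
          * ((1 + 2 / (1 / (4 * (n : ℝ) ^ (2 * m)))) * |θ n|)
        = (8 * (n : ℝ) ^ (2 * m)) ^ m * ((1 + 8 * (n : ℝ) ^ (2 * m)) * |θ n|) := by
          rw [inv_pow, one_div, inv_inv, div_div_eq_mul_div]
          ring
      _ ≤ (8 * (n : ℝ) ^ (2 * m)) ^ m * ((9 * (n : ℝ) ^ (2 * m)) * |θ n|) := by
          gcongr
          linarith
      _ = _ := by
          rw [mul_pow, ← pow_mul, pow_add]
          ring
  have hsum : Summable fun n => μ.real (E n) := by
    have h2 : Summable fun n : ℕ => 1 / (n : ℝ) ^ 2 :=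
      Real.summable_one_div_nat_pow.2 one_lt_two
    have h3 : Summable fun n : ℕ =>
        1 / (n : ℝ) ^ 2 + 8 ^ m * (9 * (1 / (n : ℝ) ^ 2)) :=
      h2.add ((h2.mul_left 9).mul_left _)
    refine summable_of_isBigO_nat h3 (Asymptotics.IsBigO.of_bound 1 ?_)
    -- Two powers beyond those in `hbound` leave a summable 1/n².
    have hev := (hθ' (2 * m * m + 2 * m + 2)).abs.eventually_lt_const
      (show |(0 : ℝ)| < 1 by simp)
    filter_upwards [hev, eventually_ge_atTop (max l 1)] with n h hn
    have hn1 : 1 ≤ n := (le_max_right _ _).trans hn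
    have hn1' : (1 : ℝ) ≤ n := by exact_mod_cast hn1
    rw [Real.norm_of_nonneg measureReal_nonneg, one_mul, Real.norm_of_nonneg (by positivity)]
    refine (hbound n hn).trans ?_
    gcongr ?_ + _ * (_ * ?_)
    · exact le_rfl
    rw [le_div_iff₀ (by positivity), mul_assoc, ← pow_add]
    rw [abs_mul, abs_of_nonneg (a := (n : ℝ) ^ _) (by positivity)] at h
    exact h.le
  have hfin : ∑' n, μ (E n) ≠ ∞ := by
    have : ∀ n, μ (E n) = ENNReal.ofReal (μ.real (E n)) := fun n => by simp
    simp_rw [this]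
    exact hsum.tsum_ofReal_ne_top
  filter_upwards [ae_eventually_notMem hfin] with q hq hqG
  filter_upwards [hq] with n hn
  by_contra! hlt
  exact hn ⟨hlt, hqG⟩

end RandomDynSys.MixedDecayBound

/-! ### Fast returns and aperiodicity -/

namespace RandomDynSys

variable {Ω X : Type*} [MeasurableSpace Ω] [MetricSpace X] [MeasurableSpace X]
  {P : Measure Ω}

/-- The points which, at some time `n ≥ 1`, come back within distance `1 / ((k + 1) n ^ Q)` of
themselves. -/
def fastReturnSet (𝒯 : RandomDynSys Ω X P) (Q k : ℕ) : Set (Ω × X) :=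
  {p | ∃ n : ℕ, 0 < n ∧ dist (𝒯.iter n p.1 p.2) p.2 < 1 / ((k + 1) * (n : ℝ) ^ Q)}

theorem measurableSet_fastReturnSet [BorelSpace X] [SecondCountableTopology X]
    (𝒯 : RandomDynSys Ω X P) (Q k : ℕ) : MeasurableSet (𝒯.fastReturnSet Q k) := by
  have : 𝒯.fastReturnSet Q k = ⋃ n : ℕ, ⋃ _ : 0 < n,
      𝒯.closeReturnSet n (1 / ((k + 1) * (n : ℝ) ^ Q)) := by
    ext p
    simp [fastReturnSet, closeReturnSet]
  rw [this]
  exact MeasurableSet.iUnion fun n => MeasurableSet.iUnion fun _ =>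
    𝒯.measurableSet_closeReturnSet _ _

theorem antitone_fastReturnSet (𝒯 : RandomDynSys Ω X P) (Q : ℕ) :
    Antitone (𝒯.fastReturnSet Q) := by
  rintro k k' hk p ⟨n, hn, h⟩
  refine ⟨n, hn, h.trans_le ?_⟩
  have : (0 : ℝ) < n := by exact_mod_cast hn
  have : (k : ℝ) ≤ k' := by exact_mod_cast hk
  gcongr

/-- Times n ≥ n₀ are covered by the quantitative bound as soon as k + 1 ≥ 4; at the finitely many
earlier times the return distance is positive, so a larger k suffices. -/
theorem exists_notMem_fastReturnSet (𝒯 : RandomDynSys Ω X P) {Q : ℕ} {p : Ω × X}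
    (h : ∀ᶠ n : ℕ in atTop, 1 / (4 * (n : ℝ) ^ Q) ≤ dist (𝒯.iter n p.1 p.2) p.2)
    (hp : ¬ ∃ n : ℕ, 0 < n ∧ 𝒯.iter n p.1 p.2 = p.2) : ∃ k, p ∉ 𝒯.fastReturnSet Q k := by
  obtain ⟨n₀, hn₀⟩ := eventually_atTop.1 h
  push Not at hp
  have hsmall : ∀ n : ℕ, ∃ k : ℕ, 0 < n → 1 / ((k : ℝ) + 1) < dist (𝒯.iter n p.1 p.2) p.2 := by
    intro n
    by_cases hn : 0 < n
    · obtain ⟨k, hk⟩ := exists_nat_one_div_lt (dist_pos.2 (hp n hn))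
      exact ⟨k, fun _ => hk⟩
    · exact ⟨0, fun h => absurd h hn⟩
  choose f hf using hsmall
  refine ⟨max 4 ((Finset.range n₀).sup f), ?_⟩
  rintro ⟨n, hn, hlt⟩
  have hn1 : (1 : ℝ) ≤ n := by exact_mod_cast hn
  have hnQ : 1 ≤ (n : ℝ) ^ Q := one_le_pow₀ hn1
  set K := max 4 ((Finset.range n₀).sup f) with hK
  by_cases hnn : n₀ ≤ n
  · have h1 := hn₀ n hnn
    have h4 : (4 : ℝ) ≤ K := by exact_mod_cast le_max_left 4 _
    have : 1 / (((K : ℝ) + 1) * (n : ℝ) ^ Q) ≤ 1 / (4 * (n : ℝ) ^ Q) := by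
      gcongr; linarith
    linarith
  · have h1 := hf n hn
    have h2 : f n ≤ K :=
      (Finset.le_sup (f := f) (Finset.mem_range.2 (not_le.1 hnn))).trans (le_max_right _ _)
    have h2' : (f n : ℝ) ≤ K := by exact_mod_cast h2
    have : 1 / (((K : ℝ) + 1) * (n : ℝ) ^ Q) ≤ 1 / ((f n : ℝ) + 1) := by
      apply one_div_le_one_div_of_le (by positivity)
      nlinarith [show (0 : ℝ) ≤ f n from by positivity]
    linarith

theorem MixedDecayBound.measure_iInter_fastReturnSet [BorelSpace X] [SecondCountableTopology X]
    {𝒯 : RandomDynSys Ω X P} {μ : Measure (Ω × X)} {θ : ℕ → ℝ} [IsProbabilityMeasure μ]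
    (hθ : 𝒯.MixedDecayBound μ θ)
    (hθ' : ∀ p : ℕ, Tendsto (fun n : ℕ => θ n * (n : ℝ) ^ p) atTop (𝓝 0))
    (haper : 𝒯.IsRandomAperiodic μ) {m : ℕ} (hm : 1 ≤ m) (l : ℕ) :
    μ ((⋂ k, 𝒯.fastReturnSet (2 * m) k) ∩ Prod.snd ⁻¹' regularPoints μ.snd m l) = 0 := by
  have h1 := hθ.ae_eventually_le_dist_iter hθ' hm l
  have h2 : ∀ᵐ p ∂μ, ¬ ∃ n : ℕ, 0 < n ∧ 𝒯.iter n p.1 p.2 = p.2 := by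
    rw [ae_iff]; simp only [not_not]; exact haper
  have h3 : ∀ᵐ p ∂μ, ¬ (p ∈ (⋂ k, 𝒯.fastReturnSet (2 * m) k) ∩
      Prod.snd ⁻¹' regularPoints μ.snd m l) := by
    filter_upwards [h1, h2] with p hp1 hp2
    rintro ⟨hpI, hpG⟩
    obtain ⟨k, hk⟩ := 𝒯.exists_notMem_fastReturnSet (hp1 hpG) hp2
    exact hk (Set.mem_iInter.1 hpI k)
  exact measure_eq_zero_iff_ae_notMem.2 h3

end RandomDynSys

/-! ### Local dimension and differentiation of measures -/

theorem exists_eventually_measureReal_ball_le_rpow {X : Type*} [MetricSpace X]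
    [MeasurableSpace X] (ν : Measure X) [IsFiniteMeasure ν] (x : X)
    (h : 0 < lowerLocalDim ν x) :
    ∃ d : ℝ, 0 < d ∧ ∀ᶠ r : ℝ in 𝓝[>] 0, ν.real (Metric.ball x r) ≤ r ^ d := by
  obtain ⟨d, hd0, hd⟩ := EReal.lt_iff_exists_real_btwn.1 h
  refine ⟨d, by exact_mod_cast hd0, ?_⟩
  have h1 : ∀ᶠ r : ℝ in 𝓝[>] 0, r < 1 := nhdsWithin_le_nhds (Iio_mem_nhds one_pos)
  filter_upwards [eventually_lt_of_lt_liminf hd, h1, self_mem_nhdsWithin]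
    with r hr hr1 (hr0 : 0 < r)
  by_cases hz : ν (Metric.ball x r) = 0
  · rw [measureReal_def, hz, ENNReal.toReal_zero]
    positivity
  have hpos : 0 < ν.real (Metric.ball x r) := ENNReal.toReal_pos hz (measure_ne_top _ _)
  rw [ENNReal.log_pos_real hz (measure_ne_top _ _), ← EReal.coe_div, EReal.coe_lt_coe_iff,
    lt_div_iff_of_neg (Real.log_neg hr0 hr1)] at hr
  rw [← Real.log_le_log_iff hpos (by positivity), Real.log_rpow hr0]
  exact hr.le

section Differentiation

variable {N : ℕ} {X : Set (EuclideanSpace ℝ (Fin N))}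

/-- Besicovitch differentiation gives the bound for closed balls; open balls are increasing unions
of these. -/
theorem ae_eventually_measure_ball_le_mul (ν : Measure X) [IsFiniteMeasure ν]
    (ρ : Measure (EuclideanSpace ℝ (Fin N))) [IsLocallyFiniteMeasure ρ] :
    ∀ᵐ x : X ∂ν, ∀ C : ℝ≥0∞, ρ.rnDeriv (ν.map Subtype.val) x < C → C ≠ ∞ →
      ∀ᶠ r : ℝ in 𝓝[>] 0, ρ (Metric.ball (x : EuclideanSpace ℝ (Fin N)) r)
        ≤ C * ν (Metric.ball x r) := by
  have hae := Besicovitch.ae_tendsto_rnDeriv ρ (ν.map Subtype.val)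
  filter_upwards [ae_of_ae_map measurable_subtype_coe.aemeasurable hae] with x hx C hC hCtop
  have hev := hx.eventually_lt_const hC
  obtain ⟨r₀, hr₀, hlt⟩ := mem_nhdsGT_iff_exists_Ioo_subset.1 hev
  have hle : ∀ s : ℝ, 0 < s → s < r₀ →
      ρ (Metric.closedBall (x : EuclideanSpace ℝ (Fin N)) s) ≤ C * ν (Metric.closedBall x s) := by
    intro s hs0 hs
    have h : ρ (Metric.closedBall (x : EuclideanSpace ℝ (Fin N)) s)
        / (ν.map Subtype.val) (Metric.closedBall x s) < C := hlt ⟨hs0, hs⟩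
    rw [Measure.map_apply measurable_subtype_coe Metric.isClosed_closedBall.measurableSet] at h
    exact (ENNReal.div_le_iff_le_mul (Or.inr hCtop) (Or.inl (measure_ne_top _ _))).1 h.le
  filter_upwards [Ioo_mem_nhdsGT hr₀] with r hr
  set y : EuclideanSpace ℝ (Fin N) := x.1 with hy
  have hr0 : 0 < r := hr.1
  -- The offset 2 keeps every radius positive, also for n = 0, as `hle` requires.
  have hunion : Metric.ball y r ⊆ ⋃ n : ℕ, Metric.closedBall y (r - r / (n + 2)) := by
    intro z hz
    have hz' : 0 < (r - dist z y) / r := div_pos (sub_pos.2 hz) hr0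
    obtain ⟨n, hn⟩ := exists_nat_one_div_lt hz'
    refine Set.mem_iUnion.2 ⟨n, ?_⟩
    rw [Metric.mem_closedBall]
    rw [lt_div_iff₀ hr0] at hn
    have : r / ((n : ℝ) + 2) ≤ 1 / ((n : ℝ) + 1) * r := by
      rw [div_mul_eq_mul_div, one_mul]
      gcongr
      norm_num
    linarith
  have hmono : Monotone fun n : ℕ => Metric.closedBall y (r - r / (n + 2)) := by
    intro n k hnk
    apply Metric.closedBall_subset_closedBall
    have : (n : ℝ) ≤ k := by exact_mod_cast hnk
    gcongr
  refine (measure_mono hunion).trans ?_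
  rw [hmono.measure_iUnion]
  refine iSup_le fun n => ?_
  have h2 : r / ((n : ℝ) + 2) < r := div_lt_self hr0 (by linarith [n.cast_nonneg (α := ℝ)])
  have h3 : 0 < r / ((n : ℝ) + 2) := by positivity
  refine (hle _ (by linarith) (by linarith [hr.2])).trans ?_
  gcongr
  exact Metric.closedBall_subset_ball (by linarith)

/-- Lebesgue measure is differentiated with respect to ν, not conversely: its density is finite
ν-almost everywhere, so c·r^N ≤ C·ν(B(x, r)). The extra factor r absorbs the constants. -/
theorem ae_eventually_pow_le_measureReal_ball (ν : Measure X) [IsFiniteMeasure ν] :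
    ∀ᵐ x : X ∂ν, ∀ᶠ r : ℝ in 𝓝[>] 0, r ^ (N + 1) ≤ ν.real (Metric.ball x r) := by
  have hfin := Measure.rnDeriv_lt_top (volume : Measure (EuclideanSpace ℝ (Fin N)))
    (ν.map Subtype.val)
  filter_upwards [ae_eventually_measure_ball_le_mul ν volume,
    ae_of_ae_map measurable_subtype_coe.aemeasurable hfin] with x hx hx'
  obtain ⟨C, hC, hCtop⟩ := exists_between hx'
  have hC0 : 0 < C.toReal := ENNReal.toReal_pos (pos_of_gt hC).ne' hCtop.ne
  set c := (volume : Measure (EuclideanSpace ℝ (Fin N))).real (Metric.ball 0 1) with hc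
  have hcpos : 0 < c := ENNReal.toReal_pos (Metric.measure_ball_pos _ _ one_pos).ne'
    Metric.isBounded_ball.measure_lt_top.ne
  have hsmall : ∀ᶠ r : ℝ in 𝓝[>] 0, r < c / C.toReal :=
    nhdsWithin_le_nhds (Iio_mem_nhds (by positivity))
  filter_upwards [hx C hC hCtop.ne, hsmall, self_mem_nhdsWithin] with r hr hrc (hr0 : 0 < r)
  have h := ENNReal.toReal_mono (ENNReal.mul_ne_top hCtop.ne (measure_ne_top _ _)) hr
  rw [Measure.addHaar_ball_of_pos _ _ hr0, finrank_euclideanSpace_fin, ENNReal.toReal_mul,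
    ENNReal.toReal_mul, ENNReal.toReal_ofReal (by positivity), ← measureReal_def,
    ← measureReal_def, ← hc] at h
  rw [lt_div_iff₀ hC0] at hrc
  have h2 : C.toReal * r ^ (N + 1) ≤ C.toReal * ν.real (Metric.ball x r) := by
    calc C.toReal * r ^ (N + 1) = r ^ N * (r * C.toReal) := by ring
      _ ≤ r ^ N * c := by gcongr
      _ ≤ _ := h
  exact le_of_mul_le_mul_left h2 hC0

/-- If sets `B k` decrease to a set that is null over `G`, then at almost every point of `G` the
proportion of `B k` over small balls is small for suitable `k`. -/
theorem ae_exists_eventually_measureReal_inter_ball_le {Ω : Type*} [MeasurableSpace Ω]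
    (hX : MeasurableSet X) (μ : Measure (Ω × X)) [IsFiniteMeasure μ] {B : ℕ → Set (Ω × X)}
    (hB : ∀ k, MeasurableSet (B k)) (hanti : Antitone B) {G : Set X} (hG : MeasurableSet G)
    (h0 : μ ((⋂ k, B k) ∩ Prod.snd ⁻¹' G) = 0) :
    ∀ᵐ x ∂μ.snd, x ∈ G → ∀ C : ℝ, 0 < C → ∃ k, ∀ᶠ r : ℝ in 𝓝[>] 0,
      μ.real ((Set.univ ×ˢ Metric.ball x r) ∩ B k) ≤ C * μ.snd.real (Metric.ball x r) := by
  set ν' : Measure (EuclideanSpace ℝ (Fin N)) := μ.snd.map Subtype.val with hν'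
  set ρ : ℕ → Measure (EuclideanSpace ℝ (Fin N)) :=
    fun k => (μ.restrict (B k)).snd.map Subtype.val with hρ
  have hemb : MeasurableEmbedding (Subtype.val : X → EuclideanSpace ℝ (Fin N)) :=
    MeasurableEmbedding.subtype_coe hX
  have hρG : ∀ k, ρ k (Subtype.val '' G) = μ (B k ∩ Prod.snd ⁻¹' G) := fun k => by
    simp only [hρ]
    rw [hemb.map_apply, Set.preimage_image_eq _ Subtype.val_injective, Measure.snd_apply hG,
      Measure.restrict_apply (measurable_snd hG), Set.inter_comm]
  have hG' : MeasurableSet (Subtype.val '' G) := hemb.measurableSet_image.2 hG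
  have htend : Tendsto (fun k => ρ k (Subtype.val '' G)) atTop (𝓝 0) := by
    simp_rw [hρG]
    rw [← h0, Set.iInter_inter]
    exact tendsto_measure_iInter_atTop
      (fun k => ((hB k).inter (measurable_snd hG)).nullMeasurableSet)
      (fun i j hij => Set.inter_subset_inter_left _ (hanti hij)) ⟨0, measure_ne_top _ _⟩
  -- Each density integrates over G to at most the mass of `ρ k`, which tends to 0; hence the
  -- infimum of the densities vanishes almost everywhere on G.
  have hint : ∫⁻ y in Subtype.val '' G, ⨅ k, (ρ k).rnDeriv ν' y ∂ν' = 0 := by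
    refine le_antisymm (ge_of_tendsto' htend fun k => ?_) zero_le
    exact (lintegral_mono fun y => iInf_le _ k).trans (Measure.setLIntegral_rnDeriv_le _)
  rw [lintegral_eq_zero_iff (Measurable.iInf fun k => Measure.measurable_rnDeriv _ _)] at hint
  have hinf := (ae_restrict_iff' hG').1 hint
  have hballs : ∀ᵐ x : X ∂μ.snd, ∀ k, ∀ C : ℝ≥0∞, (ρ k).rnDeriv ν' x < C → C ≠ ∞ →
      ∀ᶠ r : ℝ in 𝓝[>] 0, ρ k (Metric.ball (x : EuclideanSpace ℝ (Fin N)) r)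
        ≤ C * μ.snd (Metric.ball x r) :=
    ae_all_iff.2 fun k => ae_eventually_measure_ball_le_mul μ.snd (ρ k)
  filter_upwards [ae_of_ae_map measurable_subtype_coe.aemeasurable hinf, hballs]
    with x hx hb hxG C hC
  have hx0 : ⨅ k, (ρ k).rnDeriv ν' x = 0 := hx ⟨x, hxG, rfl⟩
  obtain ⟨k, hk⟩ := iInf_lt_iff.1 (hx0.trans_lt (ENNReal.ofReal_pos.2 hC))
  refine ⟨k, ?_⟩
  filter_upwards [hb k _ hk ENNReal.ofReal_ne_top] with r hr
  have hball : ρ k (Metric.ball (x : EuclideanSpace ℝ (Fin N)) r)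
      = μ ((Set.univ ×ˢ Metric.ball x r) ∩ B k) := by
    simp only [hρ]
    have hm : MeasurableSet (Metric.ball x r) := Metric.isOpen_ball.measurableSet
    rw [Measure.map_apply measurable_subtype_coe Metric.isOpen_ball.measurableSet]
    change (μ.restrict (B k)).snd (Metric.ball x r) = _
    rw [Measure.snd_apply hm, Measure.restrict_apply (measurable_snd hm), Set.univ_prod]
  rw [hball] at hr
  have h := ENNReal.toReal_mono (ENNReal.mul_ne_top ENNReal.ofReal_ne_top (measure_ne_top _ _)) hr
  rwa [ENNReal.toReal_mul, ENNReal.toReal_ofReal hC.le] at h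

end Differentiation

/-! ### Asymptotics of the gap length ⌈r^{-e}⌉ -/

section Asymptotics

theorem tendsto_rpow_nhdsGT_zero {y : ℝ} (hy : 0 < y) :
    Tendsto (fun r : ℝ => r ^ y) (𝓝[>] 0) (𝓝 0) := by
  have := (Real.continuousAt_rpow_const 0 y (Or.inr hy.le)).tendsto
  rw [Real.zero_rpow hy.ne'] at this
  exact this.mono_left nhdsWithin_le_nhds

theorem eventually_nhdsGT_zero_lt {c : ℝ} (hc : 0 < c) : ∀ᶠ r : ℝ in 𝓝[>] 0, r < c :=
  nhdsWithin_le_nhds (Iio_mem_nhds hc)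

theorem natCeil_rpow_neg_le {r e : ℝ} (hr : 0 < r) (hr1 : r < 1) (he : 0 < e) :
    (⌈r ^ (-e)⌉₊ : ℝ) ≤ 2 * r ^ (-e) := by
  have h1 : 1 ≤ r ^ (-e) := Real.one_le_rpow_of_pos_of_le_one_of_nonpos hr hr1.le (by linarith)
  linarith [Nat.ceil_lt_add_one (zero_le_one.trans h1)]

theorem tendsto_natCeil_rpow_neg {e : ℝ} (he : 0 < e) :
    Tendsto (fun r : ℝ => ⌈r ^ (-e)⌉₊) (𝓝[>] 0) atTop := by
  refine tendsto_nat_ceil_atTop.comp ?_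
  have h := (tendsto_rpow_atTop he).comp tendsto_inv_nhdsGT_zero
  refine h.congr' ?_
  filter_upwards [self_mem_nhdsWithin] with r (hr : 0 < r)
  simp only [Function.comp_apply]
  rw [Real.inv_rpow hr.le, Real.rpow_neg hr.le]

theorem tendsto_natCeil_rpow_neg_mul {e d : ℝ} (he : 0 < e) (hed : e < d) {u : ℝ → ℝ}
    (h0 : ∀ r, 0 ≤ u r) (hu : ∀ᶠ r : ℝ in 𝓝[>] 0, u r ≤ r ^ d) :
    Tendsto (fun r : ℝ => (⌈r ^ (-e)⌉₊ : ℝ) * u r) (𝓝[>] 0) (𝓝 0) := by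
  have hlim := (tendsto_rpow_nhdsGT_zero (sub_pos.2 hed)).const_mul 2
  rw [mul_zero] at hlim
  refine tendsto_of_tendsto_of_tendsto_of_le_of_le' tendsto_const_nhds hlim
    (Eventually.of_forall fun r => mul_nonneg (Nat.cast_nonneg _) (h0 r)) ?_
  filter_upwards [hu, self_mem_nhdsWithin, eventually_nhdsGT_zero_lt one_pos]
    with r hr (hr0 : 0 < r) hr1
  calc (⌈r ^ (-e)⌉₊ : ℝ) * u r ≤ (2 * r ^ (-e)) * r ^ d := by
        gcongr
        · exact h0 r
        · exact natCeil_rpow_neg_le hr0 hr1 he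
    _ = 2 * r ^ (d - e) := by
        rw [mul_assoc, ← Real.rpow_add hr0]
        ring_nf

theorem eventually_mul_natCeil_rpow_neg_pow_le {e : ℝ} (he : 0 < e) {Q : ℕ} (heQ : e * Q < 1)
    (c : ℝ) : ∀ᶠ r : ℝ in 𝓝[>] 0, c * r * (⌈r ^ (-e)⌉₊ : ℝ) ^ Q ≤ 1 := by
  have hlim := (tendsto_rpow_nhdsGT_zero (sub_pos.2 heQ)).const_mul (|c| * 2 ^ Q)
  rw [mul_zero] at hlim
  filter_upwards [hlim.eventually_lt_const one_pos, self_mem_nhdsWithin,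
    eventually_nhdsGT_zero_lt one_pos] with r hr (hr0 : 0 < r) hr1
  refine le_trans ?_ hr.le
  calc c * r * (⌈r ^ (-e)⌉₊ : ℝ) ^ Q ≤ |c| * r * (2 * r ^ (-e)) ^ Q := by
        gcongr
        · exact le_abs_self c
        · exact natCeil_rpow_neg_le hr0 hr1 he
    _ = |c| * 2 ^ Q * (r * (r ^ (-e)) ^ Q) := by ring
    _ = |c| * 2 ^ Q * r ^ (1 - e * Q) := by
        rw [← Real.rpow_natCast (r ^ (-e)), ← Real.rpow_mul hr0.le, sub_eq_add_neg,
          Real.rpow_add hr0, Real.rpow_one, neg_mul]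

/-- With n = ⌈r^{-e}⌉ one has r^{-D} ≤ n^{D/e}, so decay in n beats any power of 1/r. -/
theorem tendsto_rpow_neg_mul_of_superpolynomial {θ : ℕ → ℝ}
    (hθ : ∀ p : ℝ, 0 < p → Tendsto (fun n : ℕ => θ n * (n : ℝ) ^ p) atTop (𝓝 0))
    {e D : ℝ} (he : 0 < e) (hD : 0 < D) :
    Tendsto (fun r : ℝ => r ^ (-D) * |θ ⌈r ^ (-e)⌉₊|) (𝓝[>] 0) (𝓝 0) := by
  have h := ((hθ (D / e) (by positivity)).abs).comp (tendsto_natCeil_rpow_neg he)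
  rw [abs_zero] at h
  refine tendsto_of_tendsto_of_tendsto_of_le_of_le' tendsto_const_nhds h ?_ ?_
  · filter_upwards [self_mem_nhdsWithin] with r (hr0 : 0 < r)
    positivity
  · filter_upwards [self_mem_nhdsWithin] with r (hr0 : 0 < r)
    simp only [Function.comp_apply]
    rw [abs_mul, mul_comm, abs_of_nonneg (a := (_ : ℝ) ^ (D / e)) (by positivity)]
    gcongr
    calc r ^ (-D) = (r ^ (-e)) ^ (D / e) := by
          rw [← Real.rpow_mul hr0.le]
          congr 1
          field_simp
      _ ≤ _ := by
          gcongr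
          exact Nat.le_ceil _

end Asymptotics

/-! ### Hitting times of shrinking balls -/

namespace RandomDynSys

section

variable {Ω X : Type*} [MeasurableSpace Ω] [MeasurableSpace X] {P : Measure Ω}

theorem natCast_lt_hittingTime_iff (𝒯 : RandomDynSys Ω X P) (A : Set X) (k : ℕ) (p : Ω × X) :
    (k : ℕ∞) < 𝒯.hittingTime A p.1 p.2 ↔ p ∈ avoidSet 𝒯.skew (Set.univ ×ˢ A) k := by
  have h : ∀ j, 𝒯.skew^[j] p ∈ (Set.univ ×ˢ A : Set (Ω × X)) ↔ 𝒯.iter j p.1 p.2 ∈ A := fun j => by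
    rw [skew_iterate]; simp
  simp only [avoidSet, Set.mem_ofPred_eq, h]
  rw [← ENat.add_one_le_iff (ENat.natCast_ne_top k), hittingTime]
  simp only [le_iInf_iff]
  constructor
  · intro H j hj hjk hmem
    have := H j ⟨hj, hmem⟩
    norm_cast at this
    omega
  · rintro H j ⟨hj, hmem⟩
    norm_cast
    by_contra hlt
    exact H j hj (by omega) hmem

theorem setOf_lt_hittingTime (𝒯 : RandomDynSys Ω X P) (A : Set X) {t : ℝ} (ht : 0 ≤ t)
    (ν : Measure X) [IsFiniteMeasure ν] (hA : 0 < ν.real A) :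
    {p : Ω × X | ENNReal.ofReal t / ν A < (𝒯.hittingTime A p.1 p.2 : ℝ≥0∞)}
      = avoidSet 𝒯.skew (Set.univ ×ˢ A) ⌊t / ν.real A⌋₊ := by
  ext p
  rw [← natCast_lt_hittingTime_iff, Set.mem_ofPred_eq]
  have h1 : ENNReal.ofReal t / ν A = ENNReal.ofReal (t / ν.real A) := by
    rw [ENNReal.ofReal_div_of_pos hA, ofReal_measureReal]
  rw [h1]
  generalize 𝒯.hittingTime A p.1 p.2 = τ
  have hx : 0 ≤ t / ν.real A := by positivity
  induction τ with
  | top => simp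
  | coe n =>
    rw [ENat.toENNReal_coe, Nat.cast_lt, Nat.floor_lt hx,
      ENNReal.ofReal_lt_iff_lt_toReal hx (ENNReal.natCast_ne_top n), ENNReal.toReal_natCast]

end

section

variable {Ω X : Type*} [MeasurableSpace Ω] [MetricSpace X] [MeasurableSpace X]
  {P : Measure Ω}

/-- A point of the ball and its return to the ball are less than 2r apart, and the hypothesis makes
2r small enough to count as a fast return at every time up to n. -/
theorem prod_ball_diff_avoidSet_subset (𝒯 : RandomDynSys Ω X P) (x₀ : X) {r : ℝ} {n Q k : ℕ}
    (h : 2 * ((k : ℝ) + 1) * r * (n : ℝ) ^ Q ≤ 1) :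
    (Set.univ ×ˢ Metric.ball x₀ r) \ avoidSet 𝒯.skew (Set.univ ×ˢ Metric.ball x₀ r) n
      ⊆ (Set.univ ×ˢ Metric.ball x₀ r) ∩ 𝒯.fastReturnSet Q k := by
  rintro p ⟨hp, hp'⟩
  refine ⟨hp, ?_⟩
  simp only [avoidSet, Set.mem_ofPred_eq, not_forall, not_not] at hp'
  obtain ⟨j, hj, hjn, hmem⟩ := hp'
  rw [skew_iterate] at hmem
  have h1 : dist (𝒯.iter j p.1 p.2) x₀ < r := hmem.2
  have h2 : dist p.2 x₀ < r := hp.2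
  have h3 := dist_triangle_right (𝒯.iter j p.1 p.2) p.2 x₀
  have hr : 0 < r := dist_nonneg.trans_lt h2
  have hj' : (0 : ℝ) < j := by exact_mod_cast hj
  refine ⟨j, hj, (show _ < 2 * r by linarith).trans_le ?_⟩
  rw [le_div_iff₀ (by positivity)]
  have hjn' : (j : ℝ) ≤ n := by exact_mod_cast hjn
  calc 2 * r * (((k : ℝ) + 1) * (j : ℝ) ^ Q) ≤ 2 * r * (((k : ℝ) + 1) * (n : ℝ) ^ Q) := by gcongr
    _ = 2 * ((k : ℝ) + 1) * r * (n : ℝ) ^ Q := by ring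
    _ ≤ 1 := h

variable [BorelSpace X] {𝒯 : RandomDynSys Ω X P} {μ : Measure (Ω × X)} {θ : ℕ → ℝ}
  [IsProbabilityMeasure μ]

/-- Near a regular point with few fast returns, conditioning on a small ball hardly changes the
distribution of the hitting time of the ball. -/
theorem MixedDecayBound.exists_tendsto_zero_bound
    (hS : MeasurePreserving 𝒯.skew μ μ) (hθ : 𝒯.MixedDecayBound μ θ)
    (hθ' : ∀ p : ℝ, 0 < p → Tendsto (fun n : ℕ => θ n * (n : ℝ) ^ p) atTop (𝓝 0))
    (x₀ : X) {m : ℕ} (hm : 1 ≤ m)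
    (hlow : ∀ᶠ r : ℝ in 𝓝[>] 0, r ^ m ≤ μ.snd.real (Metric.ball x₀ r))
    (hup : ∀ᶠ r : ℝ in 𝓝[>] 0, μ.snd.real (Metric.ball x₀ r) ≤ r ^ (1 / (m : ℝ)))
    (hann : ∃ a b : ℝ, 0 < a ∧ 0 ≤ b ∧ ∃ r₀ : ℝ, 0 < r₀ ∧
      ∀ r : ℝ, 0 < r → r < r₀ → ∀ ρ : ℝ, 0 < ρ → ρ < r →
        μ.snd.real (Metric.ball x₀ r \ Metric.ball x₀ (r - ρ)) ≤ r ^ (-b) * ρ ^ a)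
    (hfast : ∀ C : ℝ, 0 < C → ∃ k, ∀ᶠ r : ℝ in 𝓝[>] 0,
      μ.real ((Set.univ ×ˢ Metric.ball x₀ r) ∩ 𝒯.fastReturnSet (2 * m) k)
        ≤ C * μ.snd.real (Metric.ball x₀ r)) :
    ∃ δ : ℝ → ℝ, Tendsto δ (𝓝[>] 0) (𝓝 0) ∧ ∀ᶠ r : ℝ in 𝓝[>] 0, ∀ k,
      |μ.real ((Set.univ ×ˢ Metric.ball x₀ r)
            ∩ avoidSet 𝒯.skew (Set.univ ×ˢ Metric.ball x₀ r) k)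
          - μ.snd.real (Metric.ball x₀ r)
            * μ.real (avoidSet 𝒯.skew (Set.univ ×ˢ Metric.ball x₀ r) k)|
        ≤ μ.snd.real (Metric.ball x₀ r) * δ r := by
  obtain ⟨a, b, ha, hb, r₀, hr₀, hann⟩ := hann
  have hm' : (0 : ℝ) < m := by exact_mod_cast hm
  -- Then e < 1/m, giving n·u → 0, and e·2m = 1/2 < 1, making returns by time n fast.
  set e : ℝ := 1 / (4 * m) with he_def
  have he : 0 < e := by positivity
  -- The cutoff width is r^κ: κ > 1 makes it less than r, and κa ≥ b + m + 1 makes the annulus mass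
  -- at most r^{m+1} ≤ u·r.
  set κ : ℝ := max 2 ((b + m + 1) / a) with hκ
  have hκ2 : 2 ≤ κ := le_max_left _ _
  have hκa : b + m + 1 ≤ κ * a := by
    rw [← div_le_iff₀ ha]; exact le_max_right _ _
  set u : ℝ → ℝ := fun r => μ.snd.real (Metric.ball x₀ r) with hu
  set n : ℝ → ℕ := fun r => ⌈r ^ (-e)⌉₊ with hn
  set U : ℝ → Set (Ω × X) := fun r => Set.univ ×ˢ Metric.ball x₀ r with hU
  have hUm : ∀ r, MeasurableSet (U r) := fun r =>
    MeasurableSet.univ.prod Metric.isOpen_ball.measurableSet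
  have hUu : ∀ r, μ.real (U r) = u r := fun r => by
    simp only [hU, hu]
    rw [measureReal_def, measureReal_def, Measure.snd_apply Metric.isOpen_ball.measurableSet,
      Set.univ_prod]
  have hu0 : ∀ r, 0 ≤ u r := fun r => measureReal_nonneg
  have hupos : ∀ᶠ r : ℝ in 𝓝[>] 0, 0 < u r := by
    filter_upwards [hlow, self_mem_nhdsWithin] with r hr (hr0 : 0 < r)
    exact (pow_pos hr0 m).trans_le hr
  have hnu : Tendsto (fun r => (n r : ℝ) * u r) (𝓝[>] 0) (𝓝 0) := by
    refine tendsto_natCeil_rpow_neg_mul he ?_ hu0 hup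
    rw [he_def]
    apply one_div_lt_one_div_of_lt hm'
    linarith
  have hret : Tendsto (fun r => μ.real (U r \ avoidSet 𝒯.skew (U r) (n r)) / u r)
      (𝓝[>] 0) (𝓝 0) := by
    rw [tendsto_order]
    refine ⟨fun c hc => Eventually.of_forall fun r =>
      hc.trans_le (div_nonneg measureReal_nonneg (hu0 r)), fun c hc => ?_⟩
    obtain ⟨k, hk⟩ := hfast (c / 2) (by positivity)
    have heQ : e * (2 * m : ℕ) < 1 := by
      rw [he_def]
      push_cast
      field_simp
      norm_num
    filter_upwards [hk, hupos,
      eventually_mul_natCeil_rpow_neg_pow_le he heQ (2 * ((k : ℝ) + 1))] with r hr hur hrn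
    rw [div_lt_iff₀ hur]
    calc μ.real (U r \ avoidSet 𝒯.skew (U r) (n r))
        ≤ μ.real (U r ∩ 𝒯.fastReturnSet (2 * m) k) :=
          measureReal_mono (𝒯.prod_ball_diff_avoidSet_subset x₀ hrn)
      _ ≤ c / 2 * u r := hr
      _ < c * u r := by
          gcongr
          linarith
  -- The exponent pays r^{-κ} for the Lipschitz constant and r^{-m} for dividing by u.
  have hθlim := tendsto_rpow_neg_mul_of_superpolynomial hθ' he
    (show 0 < κ + m by linarith)
  have hid : Tendsto (fun r : ℝ => r) (𝓝[>] 0) (𝓝 0) := nhdsWithin_le_nhds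
  refine ⟨fun r => μ.real (U r \ avoidSet 𝒯.skew (U r) (n r)) / u r + n r * u r
    + (r + 2 * (r ^ (-(κ + m)) * |θ (n r)|)), ?_, ?_⟩
  · simpa using (hret.add hnu).add (hid.add (hθlim.const_mul 2))
  filter_upwards [hupos, hlow, self_mem_nhdsWithin, eventually_nhdsGT_zero_lt one_pos,
    eventually_nhdsGT_zero_lt hr₀, (tendsto_natCeil_rpow_neg he).eventually_ge_atTop 1]
    with r hur hlr (hr0 : 0 < r) hr1 hrr₀ hn1 k
  have hρ : 0 < r ^ κ := by positivity
  have hρr : r ^ κ < r := by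
    calc r ^ κ < r ^ (1 : ℝ) := Real.rpow_lt_rpow_of_exponent_gt hr0 hr1 (by linarith)
      _ = r := Real.rpow_one r
  have : Nonempty X := ⟨x₀⟩
  have hmix := fun V hV =>
    hθ.abs_measureReal_ball_inter_sub_le (V := V) hS.measurable hn1 x₀ (r := r) hρ hV
  have key := abs_measureReal_inter_avoidSet_sub_le hS (hUm r) (n := n r)
    (η := μ.snd.real (Metric.ball x₀ r \ Metric.ball x₀ (r - r ^ κ))
      + (1 + 1 / r ^ κ) * |θ (n r)|) (fun V hV => by rw [hUu]; exact hmix V hV) k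
  rw [hUu] at key
  refine key.trans ?_
  have hlow' : r ^ (m : ℝ) ≤ u r := by rw [Real.rpow_natCast]; exact hlr
  have hA : μ.snd.real (Metric.ball x₀ r \ Metric.ball x₀ (r - r ^ κ)) ≤ u r * r := by
    calc _ ≤ r ^ (-b) * (r ^ κ) ^ a := hann r hr0 hrr₀ _ hρ hρr
      _ = r ^ (-b + κ * a) := by rw [← Real.rpow_mul hr0.le, ← Real.rpow_add hr0]
      _ ≤ r ^ ((m : ℝ) + 1) :=
          Real.rpow_le_rpow_of_exponent_ge hr0 hr1.le (by linarith)
      _ = r ^ (m : ℝ) * r := by rw [Real.rpow_add hr0, Real.rpow_one]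
      _ ≤ u r * r := by gcongr
  have hB : (1 + 1 / r ^ κ) * |θ (n r)| ≤ u r * (2 * (r ^ (-(κ + m)) * |θ (n r)|)) := by
    have h1 : 1 ≤ r ^ (-κ) :=
      Real.one_le_rpow_of_pos_of_le_one_of_nonpos hr0 hr1.le (by linarith)
    calc (1 + 1 / r ^ κ) * |θ (n r)| ≤ (2 * r ^ (-κ)) * |θ (n r)| := by
          gcongr
          rw [one_div, ← Real.rpow_neg hr0.le]
          linarith
      _ = r ^ (m : ℝ) * (2 * (r ^ (-(κ + m)) * |θ (n r)|)) := by
          have : r ^ (-κ) = r ^ (m : ℝ) * r ^ (-(κ + m)) := by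
            rw [← Real.rpow_add hr0]
            congr 1
            ring
          rw [this]
          ring
      _ ≤ _ := by gcongr
  have hC : u r * (μ.real (U r \ avoidSet 𝒯.skew (U r) (n r)) / u r)
      = μ.real (U r \ avoidSet 𝒯.skew (U r) (n r)) := mul_div_cancel₀ _ hur.ne'
  rw [mul_add, mul_add, mul_add, hC]
  linarith

/-- If conditioning on small balls around `x₀` does not change the distribution of their hitting
time in the limit, then the normalized hitting time is asymptotically exponential. -/
theorem tendsto_measureReal_hittingTime (hS : MeasurePreserving 𝒯.skew μ μ) (x₀ : X)
    (hpos : ∀ᶠ r : ℝ in 𝓝[>] 0, 0 < μ.snd.real (Metric.ball x₀ r))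
    (hzero : Tendsto (fun r => μ.snd.real (Metric.ball x₀ r)) (𝓝[>] 0) (𝓝 0))
    {δ : ℝ → ℝ} (hδ : Tendsto δ (𝓝[>] 0) (𝓝 0))
    (h : ∀ᶠ r : ℝ in 𝓝[>] 0, ∀ k,
      |μ.real ((Set.univ ×ˢ Metric.ball x₀ r)
            ∩ avoidSet 𝒯.skew (Set.univ ×ˢ Metric.ball x₀ r) k)
          - μ.snd.real (Metric.ball x₀ r)
            * μ.real (avoidSet 𝒯.skew (Set.univ ×ˢ Metric.ball x₀ r) k)|
        ≤ μ.snd.real (Metric.ball x₀ r) * δ r) {t : ℝ} (ht : 0 ≤ t) :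
    Tendsto
        (fun r : ℝ => μ.real {p : Ω × X |
          ENNReal.ofReal t / μ.snd (Metric.ball x₀ r)
            < (𝒯.hittingTime (Metric.ball x₀ r) p.1 p.2 : ℝ≥0∞)})
        (𝓝[>] 0) (𝓝 (Real.exp (-t))) ∧
      Tendsto
        (fun r : ℝ => (μ[|Set.univ ×ˢ Metric.ball x₀ r]).real {p : Ω × X |
          ENNReal.ofReal t / μ.snd (Metric.ball x₀ r)
            < (𝒯.hittingTime (Metric.ball x₀ r) p.1 p.2 : ℝ≥0∞)})
        (𝓝[>] 0) (𝓝 (Real.exp (-t))) := by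
  set u : ℝ → ℝ := fun r => μ.snd.real (Metric.ball x₀ r) with hu
  set U : ℝ → Set (Ω × X) := fun r => Set.univ ×ˢ Metric.ball x₀ r with hU
  have hUm : ∀ r, MeasurableSet (U r) := fun r =>
    MeasurableSet.univ.prod Metric.isOpen_ball.measurableSet
  have hUu : ∀ r, μ.real (U r) = u r := fun r => by
    simp only [hU, hu]
    rw [measureReal_def, measureReal_def, Measure.snd_apply Metric.isOpen_ball.measurableSet,
      Set.univ_prod]
  have hev : ∀ᶠ r : ℝ in 𝓝[>] 0, {p : Ω × X |
      ENNReal.ofReal t / μ.snd (Metric.ball x₀ r)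
        < (𝒯.hittingTime (Metric.ball x₀ r) p.1 p.2 : ℝ≥0∞)}
      = avoidSet 𝒯.skew (U r) ⌊t / u r⌋₊ :=
    hpos.mono fun r hr => 𝒯.setOf_lt_hittingTime _ ht _ hr
  have hgeom : Tendsto (fun r => (1 - u r) ^ ⌊t / u r⌋₊) (𝓝[>] 0) (𝓝 (Real.exp (-t))) :=
    (tendsto_one_sub_pow_floor_div t ht).comp
      (tendsto_nhdsWithin_iff.2 ⟨hzero, hpos⟩)
  have hlim : Tendsto (fun r => μ.real (avoidSet 𝒯.skew (U r) ⌊t / u r⌋₊)) (𝓝[>] 0)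
      (𝓝 (Real.exp (-t))) := by
    refine hgeom.congr_dist ?_
    refine squeeze_zero' (Eventually.of_forall fun _ => dist_nonneg) ?_ hδ
    filter_upwards [h, hpos] with r hr hur
    have hδ0 : 0 ≤ δ r := by
      have := (abs_nonneg _).trans (hr 0)
      exact nonneg_of_mul_nonneg_right this hur
    rw [dist_comm, Real.dist_eq, ← hUu r]
    refine abs_measureReal_avoidSet_sub_pow_le hS (hUm r) hδ0 (fun k => ?_) _
    rw [hUu]
    exact hr k
  refine ⟨hlim.congr' (hev.mono fun r hr => congrArg μ.real hr.symm), ?_⟩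
  -- Dividing the hypothesis by u compares the conditional law directly with the unconditional one.
  refine hlim.congr_dist (squeeze_zero' (Eventually.of_forall fun _ => dist_nonneg) ?_ hδ)
  filter_upwards [h, hpos, hev] with r hr hur he
  have hcond : (μ[|U r]).real (avoidSet 𝒯.skew (U r) ⌊t / u r⌋₊)
      = μ.real (U r ∩ avoidSet 𝒯.skew (U r) ⌊t / u r⌋₊) / u r := by
    rw [measureReal_def, cond_apply (hUm r), ENNReal.toReal_mul, ENNReal.toReal_inv,
      ← measureReal_def, ← measureReal_def, hUu, inv_mul_eq_div]
  rw [he, dist_comm, Real.dist_eq, hcond, div_sub' hur.ne', abs_div, abs_of_pos hur,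
    div_le_iff₀ hur, mul_comm (δ r)]
  exact hr _

end

end RandomDynSys

/-! ### Proof of the limit laws -/

theorem exists_mem_regularPoints {X : Type*} [MetricSpace X] [MeasurableSpace X]
    (ν : Measure X) (x : X) {m : ℕ} (hm : 1 ≤ m)
    (hlow : ∀ᶠ r : ℝ in 𝓝[>] 0, r ^ m ≤ ν.real (Metric.ball x r))
    (hup : ∀ᶠ r : ℝ in 𝓝[>] 0, ν.real (Metric.ball x r) ≤ r ^ (1 / (m : ℝ))) :
    ∃ l, x ∈ regularPoints ν m l := by
  have hinv : Tendsto (fun n : ℕ => (n : ℝ)⁻¹) atTop (𝓝[>] 0) :=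
    tendsto_inv_atTop_nhdsGT_zero.comp tendsto_natCast_atTop_atTop
  obtain ⟨l, hl⟩ := eventually_atTop.1 ((hinv.eventually hlow).and (hinv.eventually hup))
  refine ⟨l, fun n hn => ⟨(hl n hn).1, ?_⟩⟩
  calc ν.real (Metric.ball x (n : ℝ)⁻¹) ^ m ≤ (((n : ℝ)⁻¹) ^ (1 / (m : ℝ))) ^ m := by
        gcongr
        exact (hl n hn).2
    _ = (n : ℝ)⁻¹ := by
        rw [one_div, Real.rpow_inv_natCast_pow (by positivity) (by omega)]

theorem theorem3 {Ω : Type*} [MetricSpace Ω] [MeasurableSpace Ω] [BorelSpace Ω]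
    (P : Measure Ω) [IsProbabilityMeasure P]
    {N : ℕ} (X : Set (EuclideanSpace ℝ (Fin N))) (hX : IsCompact X)
    (𝒯 : RandomDynSys Ω X P) (μ : Measure (Ω × X)) (hμ : 𝒯.IsInvariant μ)
    (haper : 𝒯.IsRandomAperiodic μ)
    (hann : AnnulusCondition μ.snd)
    (hdecay : 𝒯.HasSuperpolynomialMixedDecay μ)
    (t : ℝ) (ht : 0 ≤ t) :
    ∀ᵐ x₀ ∂μ.snd, 0 < lowerLocalDim μ.snd x₀ →
      Tendsto
        (fun r : ℝ => μ.real {p : Ω × X |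
          ENNReal.ofReal t / μ.snd (Metric.ball x₀ r)
            < (𝒯.hittingTime (Metric.ball x₀ r) p.1 p.2 : ℝ≥0∞)})
        (𝓝[>] 0) (𝓝 (Real.exp (-t))) ∧
      Tendsto
        (fun r : ℝ => (μ[|Set.univ ×ˢ Metric.ball x₀ r]).real {p : Ω × X |
          ENNReal.ofReal t / μ.snd (Metric.ball x₀ r)
            < (𝒯.hittingTime (Metric.ball x₀ r) p.1 p.2 : ℝ≥0∞)})
        (𝓝[>] 0) (𝓝 (Real.exp (-t))) := by
  have := hμ.isProbabilityMeasure
  have hS := hμ.skew_preserving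
  obtain ⟨θ, hθ', hθ⟩ := hdecay
  replace hθ : 𝒯.MixedDecayBound μ θ := hθ
  have hθpow : ∀ p : ℕ, Tendsto (fun n : ℕ => θ n * (n : ℝ) ^ p) atTop (𝓝 0) := by
    intro p
    have h := (hθ' (p + 1) (by positivity)).abs
    rw [abs_zero] at h
    refine squeeze_zero_norm' ?_ h
    filter_upwards [eventually_ge_atTop 1] with n hn
    have hn' : (1 : ℝ) ≤ n := by exact_mod_cast hn
    rw [Real.norm_eq_abs, abs_mul, abs_mul]
    gcongr
    rw [← Real.rpow_natCast]
    exact Real.rpow_le_rpow_of_exponent_le hn' (by linarith)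
  -- The exceptional set must serve all m and l at once, since those used later depend on x₀.
  have hdens : ∀ᵐ x ∂μ.snd, ∀ m l : ℕ, 1 ≤ m → x ∈ regularPoints μ.snd m l →
      ∀ C : ℝ, 0 < C → ∃ k, ∀ᶠ r : ℝ in 𝓝[>] 0,
        μ.real ((Set.univ ×ˢ Metric.ball x r) ∩ 𝒯.fastReturnSet (2 * m) k)
          ≤ C * μ.snd.real (Metric.ball x r) := by
    refine ae_all_iff.2 fun m => ae_all_iff.2 fun l => ?_
    by_cases hm : 1 ≤ m
    · filter_upwards [ae_exists_eventually_measureReal_inter_ball_le hX.measurableSet μ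
        (fun k => 𝒯.measurableSet_fastReturnSet (2 * m) k) (𝒯.antitone_fastReturnSet _)
        (measurableSet_regularPoints μ.snd m l)
        (hθ.measure_iInter_fastReturnSet hθpow haper hm l)] with x hx _
      exact hx
    · exact Eventually.of_forall fun x h => absurd h hm
  filter_upwards [hann, hdens, ae_eventually_pow_le_measureReal_ball μ.snd]
    with x₀ hannx hdensx hlowx hdim
  obtain ⟨d, hd, hupd⟩ := exists_eventually_measureReal_ball_le_rpow μ.snd x₀ hdim
  obtain ⟨j, hj⟩ := exists_nat_one_div_lt hd
  -- A single integer serves both bounds: m ≥ N + 1 for the lower one, 1/m ≤ 1/(j + 1) < d for the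
  -- upper one.
  set m := max (N + 1) (j + 1) with hm_def
  have hm : 1 ≤ m := le_trans (by omega) (le_max_left _ _)
  have hm' : (0 : ℝ) < m := by exact_mod_cast hm
  have hmd : 1 / (m : ℝ) ≤ d := by
    refine le_trans ?_ hj.le
    have : ((j + 1 : ℕ) : ℝ) ≤ m := by exact_mod_cast le_max_right (N + 1) (j + 1)
    push_cast at this
    exact one_div_le_one_div_of_le (by positivity) this
  have hlow : ∀ᶠ r : ℝ in 𝓝[>] 0, r ^ m ≤ μ.snd.real (Metric.ball x₀ r) := by
    filter_upwards [hlowx, self_mem_nhdsWithin, eventually_nhdsGT_zero_lt one_pos]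
      with r hr (hr0 : 0 < r) hr1
    exact (pow_le_pow_of_le_one hr0.le hr1.le (le_max_left _ _)).trans hr
  have hup : ∀ᶠ r : ℝ in 𝓝[>] 0, μ.snd.real (Metric.ball x₀ r) ≤ r ^ (1 / (m : ℝ)) := by
    filter_upwards [hupd, self_mem_nhdsWithin, eventually_nhdsGT_zero_lt one_pos]
      with r hr (hr0 : 0 < r) hr1
    exact hr.trans (Real.rpow_le_rpow_of_exponent_ge hr0 hr1.le hmd)
  obtain ⟨l, hl⟩ := exists_mem_regularPoints μ.snd x₀ hm hlow hup
  obtain ⟨δ, hδ, hbound⟩ := hθ.exists_tendsto_zero_bound hS hθ' x₀ hm hlow hup hannx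
    (hdensx m l hm hl)
  refine RandomDynSys.tendsto_measureReal_hittingTime hS x₀ ?_ ?_ hδ hbound ht
  · filter_upwards [hlow, self_mem_nhdsWithin] with r hr (hr0 : 0 < r)
    exact (pow_pos hr0 m).trans_le hr
  · exact tendsto_of_tendsto_of_tendsto_of_le_of_le' tendsto_const_nhds
      (tendsto_rpow_nhdsGT_zero hd) (Eventually.of_forall fun _ => measureReal_nonneg) hupd
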